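/- Let $N\in\mathbb N$, let $\Omega\subset\mathbb R^N$ be a bounded open set, let $T>0$, and consider the problem $$\ddot v-\operatorname{div}(B\nabla v)+a\cdot\nabla v-2b\cdot\nabla\dot v=g\ \text{ in }(0,T)\times\Omega,\qquad v=0\ \text{ on }(0,T)\times\partial\Omega,\qquad v(0)=v_0,\quad \dot v(0)=v_1 .$$ Assume that $B\in C^{0,1}([0,T]\times\overline\Omega;\mathbb R^{N\times N}_{\rm sym})$, $a\in L^\infty((0,T)\times\Omega;\mathbb R^N)$, $b\in C^{0,1}([0,T]\times\overline\Omega;\mathbb R^N)$, $g\in L^2((0,T)\times\Omega)$, $v_0\in H^1_0(\Omega)$ and $v_1\in L^2(\Omega)$. Here $H^1_0(\Omega)$ is the closure of $C_c^\infty(\Omega)$ in the $H^1(\Omega)$ norm, $H^{-1}(\Omega)$ is its dual, $L^2(\Omega)\subset H^{-1}(\Omega)$ through the $L^2$ scalar product, and dots denote distributional derivatives in time. For functions $v$ on $[0,T]\times\overline\Omega$ consider the condition (A) $v\in L^2(0,T;H^1_0(\Omega))$ and $\dot v\in L^2(0,T;L^2(\Omega))$; $v(0)=v_0$ in the sense of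 $C^0([0,T];L^2(\Omega))$ and $\dot v(0)=v_1$ in the sense of $C^0([0,T];H^{-1}(\Omega))$ (that is, $v$ and $\dot v$ have representatives in these spaces, which take the values $v_0$ and $v_1$ at $t=0$). The function $v$ is a *weak solution* if (A) holds and $$-\int_0^T\langle\dot v,\dot\xi\rangle_{L^2(\Omega)}\,dt+\int_0^T\langle B\nabla v,\nabla\xi\rangle_{L^2(\Omega)}\,dt+\int_0^T\langle a\cdot\nabla v,\xi\rangle_{L^2(\Omega)}\,dt+2\int_0^T\langle\dot v,\operatorname{div}(b\,\xi)\rangle_{L^2(\Omega)}\,dt=\int_0^T\langle g,\xi\rangle_{L^2(\Omega)}\,dt$$ for every $\xi\in L^2(0,T;H^1_0(\Omega))\cap H^1_0(0,T;L^2(\Omega))$, where $H^1_0(0,T;L^2(\Omega))$ is the set of $\xi\in H^1(0,T;L^2(\Omega))$ whose continuous representative vanishes at $t=0$ and $t=T$. The function $v$ is a *strong-weak solution* if (A) holds, $\ddot v\in L^2(0,T;H^{-1}(\Omega))$, and for a.e. $t\in[0,T]$ $$\langle\ddot v(t),\phi\rangle_{H^1_0(\Omega)}+\langle B(t)\nabla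 v(t),\nabla\phi\rangle_{L^2(\Omega)}+\langle a(t)\cdot\nabla v(t),\phi\rangle_{L^2(\Omega)}+2\langle\dot v(t),\operatorname{div}(b(t)\phi)\rangle_{L^2(\Omega)}=\langle g(t),\phi\rangle_{L^2(\Omega)}\quad\text{for every }\phi\in H^1_0(\Omega),$$ where $\langle\cdot,\cdot\rangle_{H^1_0(\Omega)}$ in the first term is the duality pairing of $H^{-1}(\Omega)$ and $H^1_0(\Omega)$. Then $v$ is a weak solution if and only if it is a strong-weak solution. -/

import Mathlib

open MeasureTheory Set
open scoped ContDiff ENNReal NNReal Matrix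

noncomputable section

namespace HypWave

/-- Euclidean space `ℝ^N`. -/
abbrev E (N : ℕ) : Type := EuclideanSpace ℝ (Fin N)

/-- The space `C_c^∞(U)` of smooth functions with compact support contained in `U`. -/
def IsTestFun {V : Type*} [NormedAddCommGroup V] [NormedSpace ℝ V] (U : Set V) (φ : V → ℝ) :
    Prop :=
  ContDiff ℝ ∞ φ ∧ HasCompactSupport φ ∧ tsupport φ ⊆ U

section Space

variable {N : ℕ}

/-- The Lebesgue space `L²(Ω)`. -/
abbrev L2 (Ω : Set (E N)) : Type := Lp ℝ 2 (volume.restrict Ω)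

/-- The Lebesgue space `L²(Ω; ℝ^N)`. -/
abbrev L2vec (Ω : Set (E N)) : Type := Lp (E N) 2 (volume.restrict Ω)

/-- The pairs `(φ, ∇φ)` in `L²(Ω) × L²(Ω; ℝ^N)` with `φ ∈ C_c^∞(Ω)`. The norm of the ambient Hilbert
space is `(‖u‖² + ‖G‖²)^{1/2}`, that is, the `H¹(Ω)` norm on pairs `(u, ∇u)`. -/
def testGraph (Ω : Set (E N)) : Submodule ℝ (WithLp 2 (L2 Ω × L2vec Ω)) :=
  Submodule.span ℝ {p | ∃ φ : E N → ℝ, IsTestFun Ω φ ∧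
    p.fst =ᵐ[volume.restrict Ω] φ ∧ p.snd =ᵐ[volume.restrict Ω] gradient φ}

/-- The Sobolev space `H¹₀(Ω)`: the closure of `C_c^∞(Ω)` in the `H¹(Ω)` norm. An element is stored
together with its weak gradient, as the pair `(u, ∇u)`. -/
abbrev H10 (Ω : Set (E N)) : Type := ↥((testGraph Ω).topologicalClosure)

/-- The inclusion `H¹₀(Ω) → L²(Ω)`. -/
def H10.toL2 {Ω : Set (E N)} : H10 Ω →L[ℝ] L2 Ω :=
  (WithLp.fstL 2 ℝ (L2 Ω) (L2vec Ω)).comp (testGraph Ω).topologicalClosure.subtypeL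

/-- The weak gradient `H¹₀(Ω) → L²(Ω; ℝ^N)`. -/
def H10.grad {Ω : Set (E N)} : H10 Ω →L[ℝ] L2vec Ω :=
  (WithLp.sndL 2 ℝ (L2 Ω) (L2vec Ω)).comp (testGraph Ω).topologicalClosure.subtypeL

/-- The space `H⁻¹(Ω)`, the dual of `H¹₀(Ω)`. -/
abbrev Hneg1 (Ω : Set (E N)) : Type := StrongDual ℝ (H10 Ω)

/-- The inclusion `L²(Ω) → H⁻¹(Ω)` of the rigged Hilbert space: `w` acts on `φ` as
`⟨w, φ⟩_{L²(Ω)}`. -/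
def toHneg1 {Ω : Set (E N)} (w : L2 Ω) : Hneg1 Ω := (innerSL ℝ w).comp H10.toL2

/-- `d` is the distributional divergence in `Ω` of the vector field `F`. -/
def HasWeakDiv (Ω : Set (E N)) (F : E N → E N) (d : E N → ℝ) : Prop :=
  LocallyIntegrableOn F Ω ∧ LocallyIntegrableOn d Ω ∧
    ∀ ψ : E N → ℝ, IsTestFun Ω ψ →
      ∫ x in Ω, inner ℝ (F x) (gradient ψ x) = -∫ x in Ω, d x * ψ x

open Classical in
/-- The distributional divergence in `Ω` of a vector field whose divergence is a function. -/
def weakDiv (Ω : Set (E N)) (F : E N → E N) : E N → ℝ :=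
  if h : ∃ d, HasWeakDiv Ω F d then h.choose else 0

/-- The distributional divergence is unique up to null sets. -/
theorem HasWeakDiv.weakDiv_ae_eq {Ω : Set (E N)} (hΩ : IsOpen Ω) {F : E N → E N} {d : E N → ℝ}
    (h : HasWeakDiv Ω F d) : weakDiv Ω F =ᵐ[volume.restrict Ω] d := by
  have hex : ∃ d, HasWeakDiv Ω F d := ⟨d, h⟩
  have h' : HasWeakDiv Ω F (weakDiv Ω F) := by
    rw [weakDiv, dif_pos hex]
    exact hex.choose_spec
  obtain ⟨-, hd, h1⟩ := h
  obtain ⟨-, hd', h2⟩ := h'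
  have hint : ∀ f : E N → ℝ, LocallyIntegrableOn f Ω → ∀ ψ : E N → ℝ, IsTestFun Ω ψ →
      Integrable (fun x => f x * ψ x) (volume.restrict Ω) := by
    intro f hf ψ hψ
    have hK : IsCompact (tsupport ψ) := hψ.2.1
    have h3 : IntegrableOn (fun x => f x * ψ x) (tsupport ψ) :=
      (hf.integrableOn_compact_subset hψ.2.2 hK).mul_continuousOn
        hψ.1.continuous.continuousOn hK
    refine Integrable.integrableOn ?_
    refine (integrableOn_iff_integrable_of_support_subset ?_).1 h3
    exact (Function.support_mul_subset_right _ _).trans (subset_tsupport ψ)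
  have h4 : ∀ᵐ x, x ∈ Ω → (weakDiv Ω F - d) x = 0 := by
    refine hΩ.ae_eq_zero_of_integral_contDiff_smul_eq_zero (hd'.sub hd) ?_
    intro ψ hψ1 hψ2 hψ3
    have hψ : IsTestFun Ω ψ := ⟨hψ1, hψ2, hψ3⟩
    have h5 : ∫ x in Ω, ψ x • (weakDiv Ω F - d) x = ∫ x, ψ x • (weakDiv Ω F - d) x := by
      refine setIntegral_eq_integral_of_forall_compl_eq_zero fun x hx => ?_
      rw [image_eq_zero_of_notMem_tsupport (fun hx' => hx (hψ3 hx')), zero_smul]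
    rw [← h5]
    have h6 : ∀ x, ψ x • (weakDiv Ω F - d) x = weakDiv Ω F x * ψ x - d x * ψ x := by
      intro x
      simp only [Pi.sub_apply, smul_eq_mul]
      ring
    simp only [h6]
    rw [integral_sub (hint _ hd' ψ hψ) (hint _ hd ψ hψ)]
    linarith [h1 ψ hψ, h2 ψ hψ]
  filter_upwards [(ae_restrict_iff' hΩ.measurableSet).2 h4] with x hx
  exact sub_eq_zero.1 hx

end Space

section Time

variable {X : Type*} [NormedAddCommGroup X] [NormedSpace ℝ X]

/-- Membership in the Bochner space `L²(0,T;X)`. -/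
def MemL2Time (T : ℝ) (u : ℝ → X) : Prop := MemLp u 2 (volume.restrict (Ioo 0 T))

/-- `u'` is the distributional derivative on `(0,T)` of the `X`-valued function `u`. -/
def HasWeakTimeDeriv (T : ℝ) (u u' : ℝ → X) : Prop :=
  ∀ θ : ℝ → ℝ, IsTestFun (Ioo 0 T) θ →
    ∫ t in Ioo 0 T, deriv θ t • u t = -∫ t in Ioo 0 T, θ t • u' t

/-- `c` is a representative of `u` (an a.e. defined function on `(0,T)`) in `C⁰([0,T];X)`. -/
def IsContRep (T : ℝ) (u c : ℝ → X) : Prop :=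
  ContinuousOn c (Icc 0 T) ∧ c =ᵐ[volume.restrict (Ioo 0 T)] u

/-- `u` belongs to `C⁰([0,T];X)` (up to a null set of times) and `u(0) = x₀` there. -/
def HasInitialValue (T : ℝ) (u : ℝ → X) (x₀ : X) : Prop :=
  ∃ c : ℝ → X, IsContRep T u c ∧ c 0 = x₀

/-- `u` belongs to `H¹₀(0,T;X)` with derivative `u'`: the functions of `H¹(0,T;X)` whose continuous
representative vanishes at `0` and at `T`. -/
def MemH10Time (T : ℝ) (u u' : ℝ → X) : Prop :=
  MemL2Time T u ∧ MemL2Time T u' ∧ HasWeakTimeDeriv T u u' ∧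
    ∃ c : ℝ → X, IsContRep T u c ∧ c 0 = 0 ∧ c T = 0

end Time

section Problem

variable {N : ℕ}

/-- Coefficients, forcing term and initial data of
`v̈ - div (B ∇v) + a ⬝ ∇v - 2 b ⬝ ∇v̇ = g` in `(0,T) × Ω`, `v = 0` on `(0,T) × ∂Ω`,
`v(0) = v₀`, `v̇(0) = v₁`. -/
structure HypData (Ω : Set (E N)) where
  /-- the matrix of the second order term -/
  B : ℝ → E N → Matrix (Fin N) (Fin N) ℝ
  /-- the first order coefficient -/
  a : ℝ → E N → E N
  /-- the coefficient of the mixed derivative -/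
  b : ℝ → E N → E N
  /-- the forcing term -/
  g : ℝ → E N → ℝ
  /-- the initial position, in `H¹₀(Ω)` -/
  v₀ : H10 Ω
  /-- the initial velocity, in `L²(Ω)` -/
  v₁ : L2 Ω

/-- The regularity of the data: `B` is symmetric and Lipschitz on `[0,T] × closure Ω` (entrywise),
`a` is `L^∞`, `b` is Lipschitz on `[0,T] × closure Ω` and `g` is `L²`. -/
structure HypData.Regular {Ω : Set (E N)} (D : HypData Ω) (T : ℝ) : Prop where
  symm_B : ∀ t ∈ Icc 0 T, ∀ x ∈ closure Ω, (D.B t x).IsSymm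
  lip_B : ∀ i j, ∃ K : ℝ≥0,
    LipschitzOnWith K (fun p : ℝ × E N => D.B p.1 p.2 i j) (Icc 0 T ×ˢ closure Ω)
  bdd_a : MemLp (fun p : ℝ × E N => D.a p.1 p.2) ∞ (volume.restrict (Ioo 0 T ×ˢ Ω))
  lip_b : ∃ K : ℝ≥0,
    LipschitzOnWith K (fun p : ℝ × E N => D.b p.1 p.2) (Icc 0 T ×ˢ closure Ω)
  sq_g : MemLp (fun p : ℝ × E N => D.g p.1 p.2) 2 (volume.restrict (Ioo 0 T ×ˢ Ω))

variable {Ω : Set (E N)}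

/-- `⟨B(t) ∇u, ∇φ⟩_{L²(Ω)}`. -/
def HypData.formB (D : HypData Ω) (t : ℝ) (u φ : H10 Ω) : ℝ :=
  ∫ x in Ω, (D.B t x *ᵥ (H10.grad u x).ofLp) ⬝ᵥ (H10.grad φ x).ofLp

/-- `⟨a(t) ⬝ ∇u, φ⟩_{L²(Ω)}`. -/
def HypData.forma (D : HypData Ω) (t : ℝ) (u φ : H10 Ω) : ℝ :=
  ∫ x in Ω, inner ℝ (D.a t x) (H10.grad u x) * H10.toL2 φ x

/-- `⟨w, div (b(t) φ)⟩_{L²(Ω)}`. -/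
def HypData.formb (D : HypData Ω) (t : ℝ) (w : L2 Ω) (φ : H10 Ω) : ℝ :=
  ∫ x in Ω, w x * weakDiv Ω (fun y => H10.toL2 φ y • D.b t y) x

/-- `⟨g(t), φ⟩_{L²(Ω)}`. -/
def HypData.formg (D : HypData Ω) (t : ℝ) (φ : H10 Ω) : ℝ :=
  ∫ x in Ω, D.g t x * H10.toL2 φ x

/-- The function `v` on `[0,T] × closure Ω` (its values elsewhere play no role) is represented, as a
function of time with values in function spaces, by `V`: for a.e. `t ∈ (0,T)`, `v(t)` is the
element `V t` of `H¹₀(Ω)`. -/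
def Represents (T : ℝ) (v : ℝ → E N → ℝ) (V : ℝ → H10 Ω) : Prop :=
  ∀ᵐ t ∂(volume.restrict (Ioo 0 T)), v t =ᵐ[volume.restrict Ω] H10.toL2 (V t)

/-- Common part of the two notions of solution: `v ∈ L²(0,T;H¹₀(Ω))` (represented by `V`),
`v̇ ∈ L²(0,T;L²(Ω))` (represented by `V'`), `v(0) = v₀` in the sense of `C⁰([0,T];L²(Ω))` and
`v̇(0) = v₁` in the sense of `C⁰([0,T];H⁻¹(Ω))`. -/
structure IsAdmissible (T : ℝ) (D : HypData Ω) (v : ℝ → E N → ℝ) (V : ℝ → H10 Ω) (V' : ℝ → L2 Ω) :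
    Prop where
  repr : Represents T v V
  mem : MemL2Time T V
  mem_deriv : MemL2Time T V'
  deriv : HasWeakTimeDeriv T (fun t => H10.toL2 (V t)) V'
  init : HasInitialValue T (fun t => H10.toL2 (V t)) (H10.toL2 D.v₀)
  init_deriv : HasInitialValue T (fun t => toHneg1 (V' t)) (toHneg1 D.v₁)

/-- Weak solutions: the equation is integrated by parts in time and tested with every
`ξ ∈ L²(0,T;H¹₀(Ω)) ∩ H¹₀(0,T;L²(Ω))`, whose time derivative is `ξ'`. -/
def IsWeakSol (T : ℝ) (D : HypData Ω) (v : ℝ → E N → ℝ) : Prop :=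
  ∃ (V : ℝ → H10 Ω) (V' : ℝ → L2 Ω), IsAdmissible T D v V V' ∧
    ∀ (ξ : ℝ → H10 Ω) (ξ' : ℝ → L2 Ω), MemL2Time T ξ →
      MemH10Time T (fun t => H10.toL2 (ξ t)) ξ' →
      -(∫ t in Ioo 0 T, inner ℝ (V' t) (ξ' t))
        + (∫ t in Ioo 0 T, D.formB t (V t) (ξ t))
        + (∫ t in Ioo 0 T, D.forma t (V t) (ξ t))
        + 2 * (∫ t in Ioo 0 T, D.formb t (V' t) (ξ t))
      = ∫ t in Ioo 0 T, D.formg t (ξ t)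

/-- Strong-weak solutions: `v̈ ∈ L²(0,T;H⁻¹(Ω))` (represented by `V''`) and for a.e. `t` the equation
holds against every `φ ∈ H¹₀(Ω)`. -/
def IsStrongWeakSol (T : ℝ) (D : HypData Ω) (v : ℝ → E N → ℝ) : Prop :=
  ∃ (V : ℝ → H10 Ω) (V' : ℝ → L2 Ω) (V'' : ℝ → Hneg1 Ω), IsAdmissible T D v V V' ∧
    MemL2Time T V'' ∧ HasWeakTimeDeriv T (fun t => toHneg1 (V' t)) V'' ∧
    ∀ᵐ t ∂(volume.restrict (Ioo 0 T)), ∀ φ : H10 Ω,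
      V'' t φ + D.formB t (V t) φ + D.forma t (V t) φ + 2 * D.formb t (V' t) φ = D.formg t φ

end Problem

end HypWave

end

/-!
Write `H = H¹₀(Ω)`, `L = L²(Ω)`, `j : H → L` for the inclusion and `H⁻¹ = H*`. All terms of the
equation other than `v̈` form one element `F` of `L²(0,T;H⁻¹)`, namely `F(t) φ = ⟨g(t), φ⟩ - ⟨B(t)
∇v(t), ∇φ⟩ - ⟨a(t) ⬝ ∇v(t), φ⟩ - 2 ⟨v̇(t), div (b(t) φ)⟩`. The strong-weak formulation says that `F`
is the distributional derivative of `v̇` in `H⁻¹`, and the weak formulation says that `∫ ⟨v̇, ξ'⟩ =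
-∫ F(ξ)` for all `ξ` in `L²(0,T;H) ∩ H¹₀(0,T;L)`. The theorem is the equivalence of these two
statements about `v̇` and `F`, `hasWeakTimeDeriv_iff`.

The existence of `F` (`HypData.Regular.exists_residual`) has a pointwise part and a measurability
part. For fixed `t`, the forms in `B` and `a` are bounded because their coefficients are, and `div
(b φ) = b ⬝ ∇φ + φ div b` (`H10.weakDiv_smul_ae_eq`), where the line derivatives that make up `div
b` are bounded since `b` is Lipschitz. Each of these three forms thus has a bounded kernel, jointly
measurable in `(t,x)`, and Fubini's theorem together with the separability of `H` makes its
contribution to `F` strongly measurable (`exists_memLp_strongDual_of_sum`). The term in `g` is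
bounded for a.e. `t` by the `L²(Ω)` norm of `g(t)`, which is square integrable in time.

For the equivalence, testing with `ξ = θ(t) φ` gives one direction. In the other one `v̇` takes
values only in `L` and `ξ'` is not `H`-valued, so `F(ξ)` is not the pairing of two primitives in
dual spaces. The bounded operators `K_ε = (ε + j* j)⁻¹ j* : L → H` repair this: `K_ε (j ξ)` is a
primitive in `H` of `K_ε ξ'`, while `v̇` is a primitive of `F` in `H⁻¹`
(`HasWeakTimeDeriv.ae_eq_const_add_primitive`), and Fubini's theorem gives `∫ ⟨v̇, j K_ε ξ'⟩ = -∫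
F(K_ε j ξ)` (`integral_primitive_add_integral_primitive`). Since `j K_ε` and `K_ε j` are
contractions that converge strongly to the identity as `ε → 0` (`exists_regularization`), dominated
convergence concludes.
-/

namespace HypWave

/-! ### Measurability of functionals and of bilinear forms -/

section Measurability

variable {α : Type*} [MeasurableSpace α] {μ : Measure α}
  {H : Type*} [NormedAddCommGroup H] [InnerProductSpace ℝ H] [CompleteSpace H]
  [SecondCountableTopology H]

/-- The index set of a Hilbert basis of a separable space is countable: the balls of radius `1/2`
around the basis vectors are pairwise disjoint. -/
theorem countable_of_hilbertBasis {ι H : Type*} [NormedAddCommGroup H] [InnerProductSpace ℝ H]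
    [SecondCountableTopology H] (b : HilbertBasis ι ℝ H) : Countable ι := by
  have h : (univ : Set ι).PairwiseDisjoint fun i => Metric.ball (b i) (1 / 2) := by
    intro i _ k _ hik
    refine Metric.ball_disjoint_ball ?_
    have h1 : ‖b i - b k‖ ^ 2 = 2 := by
      rw [norm_sub_sq_real, b.orthonormal.1 i, b.orthonormal.1 k, b.orthonormal.2 hik]
      norm_num
    rw [dist_eq_norm]
    nlinarith [norm_nonneg (b i - b k)]
  have h2 := h.countable_of_isOpen (fun i _ => Metric.isOpen_ball)
    (fun i _ => ⟨b i, Metric.mem_ball_self (by norm_num)⟩)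
  exact countable_univ_iff.1 h2

/-- In a separable Hilbert space, weak measurability implies strong measurability. -/
theorem aestronglyMeasurable_of_inner {f : α → H}
    (hf : ∀ y : H, AEStronglyMeasurable (fun t => inner ℝ y (f t)) μ) :
    AEStronglyMeasurable f μ := by
  obtain ⟨w, b, -⟩ := exists_hilbertBasis ℝ H
  have := countable_of_hilbertBasis b
  refine aestronglyMeasurable_of_tendsto_ae (u := Filter.atTop)
    (f := fun (s : Finset w) t => ∑ i ∈ s, inner ℝ (b i) (f t) • b i) ?_ ?_
  · intro s
    exact Finset.aestronglyMeasurable_fun_sum _ fun i _ => (hf (b i)).smul_const (b i)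
  · filter_upwards with t
    have h := b.hasSum_repr (f t)
    simpa only [b.repr_apply_apply, HasSum, SummationFilter.unconditional_filter] using h

theorem aestronglyMeasurable_strongDual {F : α → StrongDual ℝ H}
    (hF : ∀ φ : H, AEStronglyMeasurable (fun t => F t φ) μ) : AEStronglyMeasurable F μ := by
  have h : AEStronglyMeasurable (fun t => (InnerProductSpace.toDual ℝ H).symm (F t)) μ := by
    refine aestronglyMeasurable_of_inner fun y => ?_
    refine (hF y).congr (.of_forall fun t => ?_)
    simp only
    rw [real_inner_comm, InnerProductSpace.toDual_symm_apply]
  simpa using (InnerProductSpace.toDual ℝ H).continuous.comp_aestronglyMeasurable h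

/-- A family of bounded functionals that is measurable in the parameter stays measurable when it is
evaluated along a measurable function. -/
theorem aestronglyMeasurable_apply_of_ae_clm {U : Type*} [NormedAddCommGroup U] [NormedSpace ℝ U]
    {f : α → U → ℝ} {u : α → U} (hf : ∀ᵐ t ∂μ, ∃ A : U →L[ℝ] ℝ, ∀ w, A w = f t w)
    (hm : ∀ w, AEStronglyMeasurable (fun t => f t w) μ) (hu : AEStronglyMeasurable u μ) :
    AEStronglyMeasurable (fun t => f t (u t)) μ := by
  obtain ⟨u', hu', hae⟩ := hu
  refine aestronglyMeasurable_of_tendsto_ae (u := Filter.atTop)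
    (f := fun n t => f t (hu'.approx n t)) ?_ ?_
  · intro n
    have h : (fun t => f t (hu'.approx n t)) =
        fun t => ∑ y ∈ (hu'.approx n).range,
          ((hu'.approx n) ⁻¹' {y}).indicator (fun t => f t y) t := by
      funext t
      rw [Finset.sum_eq_single (hu'.approx n t)]
      · simp
      · intro y _ hy
        exact indicator_of_notMem (fun h => hy (by simpa using h.symm)) _
      · intro h
        exact absurd ((hu'.approx n).mem_range_self t) h
    rw [h]
    exact Finset.aestronglyMeasurable_fun_sum _ fun y _ =>
      (hm y).indicator ((hu'.approx n).measurableSet_preimage _)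
  · filter_upwards [hf, hae] with t ⟨A, hA⟩ ht
    simp only [← hA, ht]
    exact (A.continuous.tendsto _).comp (hu'.tendsto_approx t)

/-- Bounded functionals `β t` whose bounds are square integrable in `t` form an element of the
Bochner space of square integrable functions with values in the dual. -/
theorem exists_memLp_strongDual {β : α → H → ℝ} {γ : α → ℝ} (hγ : MemLp γ 2 μ)
    (hβ : ∀ᵐ t ∂μ, ∃ A : StrongDual ℝ H, (∀ φ, A φ = β t φ) ∧ ‖A‖ ≤ γ t)
    (hm : ∀ φ, AEStronglyMeasurable (fun t => β t φ) μ) :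
    ∃ F : α → StrongDual ℝ H, MemLp F 2 μ ∧ ∀ᵐ t ∂μ, ∀ φ, F t φ = β t φ := by
  have hch : ∀ t, ∃ A : StrongDual ℝ H,
      (∃ A : StrongDual ℝ H, (∀ φ, A φ = β t φ) ∧ ‖A‖ ≤ γ t) →
        (∀ φ, A φ = β t φ) ∧ ‖A‖ ≤ γ t := by
    intro t
    by_cases h : ∃ A : StrongDual ℝ H, (∀ φ, A φ = β t φ) ∧ ‖A‖ ≤ γ t
    · exact ⟨h.choose, fun _ => h.choose_spec⟩
    · exact ⟨0, fun h' => absurd h' h⟩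
  choose F hF using hch
  refine ⟨F, hγ.mono ?_ ?_, ?_⟩
  · refine aestronglyMeasurable_strongDual fun φ => (hm φ).congr ?_
    filter_upwards [hβ] with t ht using ((hF t ht).1 φ).symm
  · filter_upwards [hβ] with t ht using (hF t ht).2.trans (le_abs_self _)
  · filter_upwards [hβ] with t ht using (hF t ht).1

end Measurability

/-! ### Bilinear forms given by bounded kernels -/

section Kernel

variable {Y : Type*} [MeasurableSpace Y] {μ : Measure Y}
  {E₁ E₂ : Type*} [NormedAddCommGroup E₁] [NormedSpace ℝ E₁]
  [NormedAddCommGroup E₂] [NormedSpace ℝ E₂]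

theorem integral_norm_mul_norm_le {E₁ E₂ : Type*} [NormedAddCommGroup E₁] [NormedAddCommGroup E₂]
    (f : Lp E₁ 2 μ) (g : Lp E₂ 2 μ) :
    Integrable (fun x => ‖f x‖ * ‖g x‖) μ ∧ ∫ x, ‖f x‖ * ‖g x‖ ∂μ ≤ ‖f‖ * ‖g‖ := by
  have hf := (Lp.memLp f).norm
  have hg := (Lp.memLp g).norm
  refine ⟨hf.integrable_mul hg, ?_⟩
  have h1 : ‖hf.toLp _‖ = ‖f‖ := by rw [Lp.norm_toLp, eLpNorm_norm, Lp.norm_def]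
  have h2 : ‖hg.toLp _‖ = ‖g‖ := by rw [Lp.norm_toLp, eLpNorm_norm, Lp.norm_def]
  rw [← h1, ← h2, mul_comm ‖hf.toLp _‖]
  refine le_trans (le_of_eq ?_) (real_inner_le_norm (hg.toLp _) (hf.toLp _))
  rw [L2.inner_def]
  refine integral_congr_ae ?_
  filter_upwards [hf.coeFn_toLp, hg.coeFn_toLp] with x hx hy
  rw [hx, hy]
  simp

theorem aestronglyMeasurable_kernel {k : Y → E₁ →L[ℝ] E₂ →L[ℝ] ℝ} {f : Y → E₁} {g : Y → E₂}
    (hk : AEStronglyMeasurable k μ) (hf : AEStronglyMeasurable f μ)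
    (hg : AEStronglyMeasurable g μ) : AEStronglyMeasurable (fun x => k x (f x) (g x)) μ :=
  isBoundedBilinearMap_apply.continuous.comp_aestronglyMeasurable
    ((isBoundedBilinearMap_apply.continuous.comp_aestronglyMeasurable (hk.prodMk hf)).prodMk hg)

/-- A bounded measurable field of bilinear forms defines a bounded bilinear form on `L²`. -/
theorem exists_clm_of_kernel {k : Y → E₁ →L[ℝ] E₂ →L[ℝ] ℝ} {C : ℝ}
    (hk : AEStronglyMeasurable k μ) (hC : ∀ᵐ x ∂μ, ‖k x‖ ≤ C) (hC0 : 0 ≤ C) :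
    ∃ A : Lp E₁ 2 μ →L[ℝ] Lp E₂ 2 μ →L[ℝ] ℝ,
      (∀ f g, Integrable (fun x => k x (f x) (g x)) μ ∧ A f g = ∫ x, k x (f x) (g x) ∂μ) ∧
        ‖A‖ ≤ C := by
  have hb : ∀ (f : Lp E₁ 2 μ) (g : Lp E₂ 2 μ), ∀ᵐ x ∂μ,
      ‖k x (f x) (g x)‖ ≤ C * (‖f x‖ * ‖g x‖) := by
    intro f g
    filter_upwards [hC] with x hx
    calc ‖k x (f x) (g x)‖ ≤ ‖k x‖ * ‖f x‖ * ‖g x‖ := (k x).le_opNorm₂ _ _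
      _ ≤ C * ‖f x‖ * ‖g x‖ := by gcongr
      _ = _ := by ring
  have hi : ∀ (f : Lp E₁ 2 μ) (g : Lp E₂ 2 μ), Integrable (fun x => k x (f x) (g x)) μ := by
    intro f g
    refine ((integral_norm_mul_norm_le f g).1.const_mul C).mono' ?_ (hb f g)
    exact aestronglyMeasurable_kernel hk (Lp.aestronglyMeasurable f) (Lp.aestronglyMeasurable g)
  let B : Lp E₁ 2 μ →ₗ[ℝ] Lp E₂ 2 μ →ₗ[ℝ] ℝ := LinearMap.mk₂ ℝ
    (fun f g => ∫ x, k x (f x) (g x) ∂μ)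
    (by
      intro f f' g
      rw [← integral_add (hi f g) (hi f' g)]
      refine integral_congr_ae ?_
      filter_upwards [Lp.coeFn_add f f'] with x hx
      rw [hx]
      simp)
    (by
      intro c f g
      rw [smul_eq_mul, ← integral_const_mul]
      refine integral_congr_ae ?_
      filter_upwards [Lp.coeFn_smul c f] with x hx
      simp [hx])
    (by
      intro f g g'
      rw [← integral_add (hi f g) (hi f g')]
      refine integral_congr_ae ?_
      filter_upwards [Lp.coeFn_add g g'] with x hx
      rw [hx]
      simp)
    (by
      intro c f g
      rw [smul_eq_mul, ← integral_const_mul]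
      refine integral_congr_ae ?_
      filter_upwards [Lp.coeFn_smul c g] with x hx
      simp [hx])
  have hB : ∀ f g, ‖B f g‖ ≤ C * ‖f‖ * ‖g‖ := by
    intro f g
    calc ‖∫ x, k x (f x) (g x) ∂μ‖ ≤ ∫ x, C * (‖f x‖ * ‖g x‖) ∂μ :=
          norm_integral_le_of_norm_le ((integral_norm_mul_norm_le f g).1.const_mul C) (hb f g)
      _ = C * ∫ x, ‖f x‖ * ‖g x‖ ∂μ := integral_const_mul _ _
      _ ≤ C * (‖f‖ * ‖g‖) := by gcongr; exact (integral_norm_mul_norm_le f g).2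
      _ = _ := by ring
  exact ⟨B.mkContinuous₂ C hB, fun f g => ⟨hi f g, rfl⟩, LinearMap.mkContinuous₂_norm_le _ hC0 hB⟩

theorem memLp_sum_smul_const {ι Z : Type*} [Fintype ι] [NormedAddCommGroup Z] [NormedSpace ℝ Z]
    {f : ι → Y → ℝ} {p : ℝ≥0∞} (hf : ∀ i, MemLp (f i) p μ) (β : ι → Z) :
    MemLp (fun x => ∑ i, f i x • β i) p μ :=
  memLp_finsetSum _ fun i _ => (ContinuousLinearMap.toSpanSingleton ℝ (β i)).comp_memLp' (hf i)

variable {α : Type*} [MeasurableSpace α] {τ : Measure α} [SFinite μ]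
  {H : Type*} [NormedAddCommGroup H] [InnerProductSpace ℝ H] [CompleteSpace H]
  [SecondCountableTopology H]

/-- A bounded kernel `k(t,x)` and a function `u` in `L²(0,T;L²)` define an element of
`L²(0,T;H*)`. -/
theorem exists_memLp_strongDual_of_kernel {k : α × Y → E₁ →L[ℝ] E₂ →L[ℝ] ℝ}
    (hk : MemLp k ⊤ (τ.prod μ)) {u : α → Lp E₁ 2 μ} (hu : MemLp u 2 τ) (P : H →L[ℝ] Lp E₂ 2 μ) :
    ∃ F : α → StrongDual ℝ H, MemLp F 2 τ ∧
      ∀ᵐ t ∂τ, ∀ φ, Integrable (fun x => k (t, x) (u t x) (P φ x)) μ ∧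
        F t φ = ∫ x, k (t, x) (u t x) (P φ x) ∂μ := by
  obtain ⟨C, hC0, hC⟩ : ∃ C : ℝ, 0 ≤ C ∧ ∀ᵐ p ∂(τ.prod μ), ‖k p‖ ≤ C := by
    refine ⟨(eLpNorm k ⊤ (τ.prod μ)).toReal, ENNReal.toReal_nonneg, ?_⟩
    rw [eLpNorm_exponent_top]
    filter_upwards [ae_le_eLpNormEssSup (f := k) (μ := τ.prod μ)] with p hp
    have hfin : eLpNormEssSup k (τ.prod μ) ≠ ⊤ := by simpa using hk.2.ne
    simpa using ENNReal.toReal_mono hfin hp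
  have hA : ∀ᵐ t ∂τ, ∃ A : Lp E₁ 2 μ →L[ℝ] Lp E₂ 2 μ →L[ℝ] ℝ,
      (∀ f g, Integrable (fun x => k (t, x) (f x) (g x)) μ ∧
        A f g = ∫ x, k (t, x) (f x) (g x) ∂μ) ∧ ‖A‖ ≤ C := by
    filter_upwards [hk.1.prodMk_left, Measure.ae_ae_of_ae_prod hC] with t ht1 ht2
    exact exists_clm_of_kernel ht1 ht2 hC0
  have hβ : ∀ᵐ t ∂τ, ∃ A : StrongDual ℝ H,
      (∀ φ, A φ = ∫ x, k (t, x) (u t x) (P φ x) ∂μ) ∧ ‖A‖ ≤ C * ‖P‖ * ‖u t‖ := by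
    filter_upwards [hA] with t ⟨A, hA1, hA2⟩
    refine ⟨(A (u t)).comp P, fun φ => (hA1 _ _).2, ?_⟩
    calc ‖(A (u t)).comp P‖ ≤ ‖A (u t)‖ * ‖P‖ := ContinuousLinearMap.opNorm_comp_le _ _
      _ ≤ ‖A‖ * ‖u t‖ * ‖P‖ := by gcongr; exact A.le_opNorm _
      _ ≤ C * ‖u t‖ * ‖P‖ := by gcongr
      _ = _ := by ring
  have hm : ∀ φ, AEStronglyMeasurable (fun t => ∫ x, k (t, x) (u t x) (P φ x) ∂μ) τ := by
    intro φ
    refine aestronglyMeasurable_apply_of_ae_clm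
      (f := fun t w => ∫ x, k (t, x) (w x) (P φ x) ∂μ) ?_ ?_ hu.1
    · filter_upwards [hA] with t ⟨A, hA1, _⟩
      exact ⟨A.flip (P φ), fun w => (hA1 _ _).2⟩
    · intro w
      refine AEStronglyMeasurable.integral_prod_right'
        (f := fun p : α × Y => k p (w p.2) (P φ p.2)) ?_
      exact aestronglyMeasurable_kernel hk.1 (Lp.aestronglyMeasurable w).comp_snd
        (Lp.aestronglyMeasurable (P φ)).comp_snd
  obtain ⟨F, hF, hF'⟩ := exists_memLp_strongDual (hu.norm.const_mul _) hβ hm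
  refine ⟨F, hF, ?_⟩
  filter_upwards [hA, hF'] with t ⟨A, hA1, _⟩ ht φ
  exact ⟨(hA1 _ _).1, ht φ⟩

/-- The case of a kernel that is a finite sum of products of bounded coefficients `f i` with fixed
functionals `ℓ i` and `m i`. -/
theorem exists_memLp_strongDual_of_sum {ι : Type*} [Fintype ι] {f : ι → α × Y → ℝ}
    (hf : ∀ i, MemLp (f i) ⊤ (τ.prod μ)) (ℓ : ι → StrongDual ℝ E₁) (m : ι → StrongDual ℝ E₂)
    {u : α → Lp E₁ 2 μ} (hu : MemLp u 2 τ) (P : H →L[ℝ] Lp E₂ 2 μ) :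
    ∃ F : α → StrongDual ℝ H, MemLp F 2 τ ∧ ∀ᵐ t ∂τ, ∀ φ,
      Integrable (fun x => ∑ i, f i (t, x) * (ℓ i (u t x) * m i (P φ x))) μ ∧
        F t φ = ∫ x, ∑ i, f i (t, x) * (ℓ i (u t x) * m i (P φ x)) ∂μ := by
  let β : ι → E₁ →L[ℝ] E₂ →L[ℝ] ℝ := fun i =>
    (ContinuousLinearMap.mul ℝ ℝ).bilinearComp (ℓ i) (m i)
  have hk : MemLp (fun p => ∑ i, f i p • β i) ⊤ (τ.prod μ) :=
    memLp_sum_smul_const hf β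
  obtain ⟨F, hF, hF'⟩ := exists_memLp_strongDual_of_kernel hk hu P
  refine ⟨F, hF, ?_⟩
  have h : ∀ p y z, (∑ i, f i p • β i) y z = ∑ i, f i p * (ℓ i y * m i z) := by
    intro p y z
    simp only [sum_apply, smul_apply, smul_eq_mul]
    rfl
  filter_upwards [hF'] with t ht φ
  simpa only [h] using ht φ

end Kernel

/-! ### Weak derivatives in time -/

section TimeDeriv

variable {X Y Z : Type*} [NormedAddCommGroup X] [NormedSpace ℝ X]
  [NormedAddCommGroup Y] [NormedSpace ℝ Y] [CompleteSpace Y]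
  [NormedAddCommGroup Z] [NormedSpace ℝ Z] [CompleteSpace Z]

theorem setIntegral_Iic_restrict_Ioo (f : ℝ → X) {t T : ℝ} (ht : t ∈ Ioo 0 T) :
    ∫ s in Iic t, f s ∂(volume.restrict (Ioo 0 T)) = ∫ s in (0 : ℝ)..t, f s := by
  rw [Measure.restrict_restrict measurableSet_Iic, intervalIntegral.integral_of_le ht.1.le]
  congr 2
  ext s
  simp only [mem_inter_iff, mem_Iic, mem_Ioo, mem_Ioc]
  constructor
  · rintro ⟨h1, h2, -⟩
    exact ⟨h2, h1⟩
  · rintro ⟨h1, h2⟩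
    exact ⟨h2, h1, h2.trans_lt ht.2⟩

theorem integral_Ioo_eq_intervalIntegral (f : ℝ → X) {T : ℝ} (hT : 0 < T) :
    ∫ t in Ioo 0 T, f t = ∫ t in (0 : ℝ)..T, f t := by
  rw [intervalIntegral.integral_of_le hT.le, integral_Ioc_eq_integral_Ioo]

theorem integrableOn_smul_of_hasCompactSupport {T : ℝ} {u : ℝ → X} (hu : IntegrableOn u (Ioo 0 T))
    {θ : ℝ → ℝ} (hθ : Continuous θ) (hc : HasCompactSupport θ) :
    IntegrableOn (fun t => θ t • u t) (Ioo 0 T) := by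
  obtain ⟨C, hC⟩ := hc.exists_bound_of_continuous hθ
  exact Integrable.bdd_smul hu C hθ.aestronglyMeasurable (.of_forall hC)

variable [CompleteSpace X]

/-- Integration by parts for primitives of Bochner integrable functions: both sides are the integral
of `β (f s) (g t)` over the square, split along the diagonal. -/
theorem integral_primitive_add_integral_primitive (β : X →L[ℝ] Y →L[ℝ] Z) {T : ℝ} {f : ℝ → X}
    {g : ℝ → Y} (hf : IntegrableOn f (Ioo 0 T)) (hg : IntegrableOn g (Ioo 0 T)) :
    (∫ t in Ioo 0 T, β (∫ s in (0 : ℝ)..t, f s) (g t))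
      + (∫ s in Ioo 0 T, β (f s) (∫ t in (0 : ℝ)..s, g t))
      = β (∫ s in Ioo 0 T, f s) (∫ t in Ioo 0 T, g t) := by
  set ν := volume.restrict (Ioo 0 T) with hν
  have hint : Integrable (fun z : ℝ × ℝ => β (f z.1) (g z.2)) (ν.prod ν) :=
    hf.op_fst_snd (by fun_prop) ⟨‖β‖, β.le_opNorm₂⟩ hg
  have hS : MeasurableSet {z : ℝ × ℝ | z.1 ≤ z.2} := measurableSet_le measurable_fst measurable_snd
  have h1 : ∫ z in {z : ℝ × ℝ | z.1 ≤ z.2}, β (f z.1) (g z.2) ∂(ν.prod ν)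
      = ∫ t, β (∫ s in (0 : ℝ)..t, f s) (g t) ∂ν := by
    rw [← integral_indicator hS, integral_prod_symm _ (hint.indicator hS)]
    refine integral_congr_ae ?_
    filter_upwards [ae_restrict_mem measurableSet_Ioo] with t ht
    rw [← setIntegral_Iic_restrict_Ioo f ht]
    have h2 : ∀ s, ({z : ℝ × ℝ | z.1 ≤ z.2}.indicator (fun z => β (f z.1) (g z.2)) (s, t))
        = (Iic t).indicator (fun s => β.flip (g t) (f s)) s := fun s => rfl
    simp only [h2]
    rw [integral_indicator measurableSet_Iic,
      ContinuousLinearMap.integral_comp_comm _ (Integrable.integrableOn hf)]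
    rfl
  have h3 : ∫ z in {z : ℝ × ℝ | z.1 ≤ z.2}ᶜ, β (f z.1) (g z.2) ∂(ν.prod ν)
      = ∫ s, β (f s) (∫ t in (0 : ℝ)..s, g t) ∂ν := by
    rw [← integral_indicator hS.compl, integral_prod _ (hint.indicator hS.compl)]
    refine integral_congr_ae ?_
    filter_upwards [ae_restrict_mem measurableSet_Ioo] with s hs
    rw [← setIntegral_Iic_restrict_Ioo g hs, integral_Iic_eq_integral_Iio]
    have h2 : ∀ t, ({z : ℝ × ℝ | z.1 ≤ z.2}ᶜ.indicator (fun z => β (f z.1) (g z.2)) (s, t))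
        = (Iio s).indicator (fun t => β (f s) (g t)) t := by
      intro t
      by_cases h : s ≤ t
      · rw [indicator_of_notMem (by simpa using h), indicator_of_notMem (by simpa using h)]
      · rw [indicator_of_mem (by simpa using h), indicator_of_mem (by simpa using h)]
    simp only [h2]
    rw [integral_indicator measurableSet_Iio,
      ContinuousLinearMap.integral_comp_comm _ (Integrable.integrableOn hg)]
  rw [← h1, ← h3, integral_add_compl hS hint, integral_prod_bilin β hf hg]

theorem IsTestFun.deriv_props {T : ℝ} {θ : ℝ → ℝ} (hθ : IsTestFun (Ioo 0 T) θ) :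
    Continuous (deriv θ) ∧ HasCompactSupport (deriv θ) ∧ θ 0 = 0 ∧ θ T = 0 ∧
      ∀ t, ∫ s in (0 : ℝ)..t, deriv θ s = θ t := by
  have hd : Continuous (deriv θ) := hθ.1.continuous_deriv (by simp)
  have h0 : θ 0 = 0 := image_eq_zero_of_notMem_tsupport fun h => (hθ.2.2 h).1.false
  refine ⟨hd, hθ.2.1.deriv, h0,
    image_eq_zero_of_notMem_tsupport fun h => (hθ.2.2 h).2.false, fun t => ?_⟩
  rw [intervalIntegral.integral_deriv_eq_sub
    (fun x _ => (hθ.1.differentiable (by simp)).differentiableAt) (hd.intervalIntegrable _ _), h0,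
    sub_zero]

/-- A test function whose integral vanishes has a test function as its primitive. -/
theorem isTestFun_primitive {T : ℝ} (hT : 0 < T) {ρ : ℝ → ℝ} (hρ : IsTestFun (Ioo 0 T) ρ)
    (h0 : ∫ t in Ioo 0 T, ρ t = 0) :
    IsTestFun (Ioo 0 T) (fun t => ∫ s in (0 : ℝ)..t, ρ s) ∧
      deriv (fun t => ∫ s in (0 : ℝ)..t, ρ s) = ρ := by
  have hc : Continuous ρ := hρ.1.continuous
  have hder : ∀ t, HasDerivAt (fun t => ∫ s in (0 : ℝ)..t, ρ s) (ρ t) t := fun t =>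
    intervalIntegral.integral_hasDerivAt_right (hc.intervalIntegrable _ _)
      (hc.stronglyMeasurableAtFilter _ _) hc.continuousAt
  have hd : deriv (fun t => ∫ s in (0 : ℝ)..t, ρ s) = ρ := funext fun t => (hder t).deriv
  have hsm : ContDiff ℝ ∞ (fun t => ∫ s in (0 : ℝ)..t, ρ s) := by
    rw [contDiff_infty_iff_deriv, hd]
    exact ⟨fun t => (hder t).differentiableAt, hρ.1⟩
  rw [integral_Ioo_eq_intervalIntegral _ hT] at h0
  obtain ⟨a, b, ha, hb, hab⟩ : ∃ a b, 0 < a ∧ b < T ∧ tsupport ρ ⊆ Icc a b := by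
    by_cases hne : (tsupport ρ).Nonempty
    · obtain ⟨a, ha, ha'⟩ := hρ.2.1.isCompact.exists_isLeast hne
      obtain ⟨b, hb, hb'⟩ := hρ.2.1.isCompact.exists_isGreatest hne
      exact ⟨a, b, (hρ.2.2 ha).1, (hρ.2.2 hb).2, fun t ht => ⟨ha' ht, hb' ht⟩⟩
    · rw [not_nonempty_iff_eq_empty] at hne
      exact ⟨T / 2, T / 2, by positivity, by linarith, by simp [hne]⟩
  have hz : ∀ t, t ∉ Icc a b → ρ t = 0 := fun t ht =>
    image_eq_zero_of_notMem_tsupport fun h => ht (hab h)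
  have hsupp : tsupport (fun t => ∫ s in (0 : ℝ)..t, ρ s) ⊆ Icc a b := by
    refine closure_minimal (fun t ht => ?_) isClosed_Icc
    by_contra htn
    refine ht ?_
    simp only [mem_Icc, not_and_or, not_le] at htn
    rcases htn with h | h
    · refine intervalIntegral.integral_zero_ae (.of_forall fun s hs => hz s fun hs' => ?_)
      have := hs.2.trans_lt (max_lt ha h)
      exact absurd hs'.1 (not_le.2 this)
    · have h1 : ∫ s in t..T, ρ s = 0 := by
        refine intervalIntegral.integral_zero_ae (.of_forall fun s hs => hz s fun hs' => ?_)
        have := (lt_min h hb).trans hs.1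
        exact absurd hs'.2 (not_le.2 this)
      have h2 := intervalIntegral.integral_add_adjacent_intervals
        (hc.intervalIntegrable (μ := volume) 0 t) (hc.intervalIntegrable t T)
      simpa [h1, h0] using h2
  refine ⟨⟨hsm, isCompact_Icc.of_isClosed_subset (isClosed_tsupport _) hsupp,
    hsupp.trans fun t ht => ⟨ha.trans_le ht.1, ht.2.trans_lt hb⟩⟩, hd⟩

/-- A function that is orthogonal to the derivatives of all test functions is constant. -/
theorem ae_eq_const_of_integral_deriv_smul_eq_zero {T : ℝ} (hT : 0 < T) {w : ℝ → X}
    (hw : IntegrableOn w (Ioo 0 T))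
    (h : ∀ θ : ℝ → ℝ, IsTestFun (Ioo 0 T) θ → ∫ t in Ioo 0 T, deriv θ t • w t = 0) :
    ∃ c : X, ∀ᵐ t ∂(volume.restrict (Ioo 0 T)), w t = c := by
  obtain ⟨χ, hχ, hχ1⟩ : ∃ χ : ℝ → ℝ, IsTestFun (Ioo 0 T) χ ∧ ∫ t in Ioo 0 T, χ t = 1 := by
    let f : ContDiffBump (T / 2 : ℝ) := ⟨T / 8, T / 4, by positivity, by linarith⟩
    have hs : tsupport (f.normed volume) ⊆ Ioo 0 T := by
      rw [f.tsupport_normed_eq]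
      intro t ht
      rw [Real.closedBall_eq_Icc] at ht
      have h1 : f.rOut = T / 4 := rfl
      rw [h1] at ht
      exact ⟨by linarith [ht.1], by linarith [ht.2]⟩
    refine ⟨f.normed volume, ⟨f.contDiff_normed, f.hasCompactSupport_normed, hs⟩, ?_⟩
    rw [setIntegral_eq_integral_of_forall_compl_eq_zero, f.integral_normed]
    exact fun t ht => image_eq_zero_of_notMem_tsupport fun h => ht (hs h)
  refine ⟨∫ t in Ioo 0 T, χ t • w t, ?_⟩
  set c := ∫ t in Ioo 0 T, χ t • w t with hc
  have hcint : IntegrableOn (fun _ : ℝ => c) (Ioo 0 T) := integrableOn_const (by simp)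
  suffices h0 : ∀ᵐ t, t ∈ Ioo 0 T → w t - c = 0 by
    filter_upwards [(ae_restrict_iff' measurableSet_Ioo).2 h0] with t ht using sub_eq_zero.1 ht
  refine isOpen_Ioo.ae_eq_zero_of_integral_contDiff_smul_eq_zero
    (hw.sub hcint).locallyIntegrableOn ?_
  intro ψ h1 h2 h3
  have hψ : IsTestFun (Ioo 0 T) ψ := ⟨h1, h2, h3⟩
  rw [← setIntegral_eq_integral_of_forall_compl_eq_zero (s := Ioo 0 T)
    (fun t ht => by rw [image_eq_zero_of_notMem_tsupport (fun h => ht (h3 h)), zero_smul])]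
  set m := ∫ t in Ioo 0 T, ψ t with hm
  have hi : ∀ θ : ℝ → ℝ, IsTestFun (Ioo 0 T) θ → IntegrableOn θ (Ioo 0 T) := fun θ hθ =>
    (hθ.1.continuous.integrable_of_hasCompactSupport hθ.2.1).integrableOn
  have hρ : IsTestFun (Ioo 0 T) (fun t => ψ t - m * χ t) := by
    refine ⟨h1.sub (contDiff_const.mul hχ.1), h2.sub (hχ.2.1.mul_left), ?_⟩
    refine (tsupport_sub _ _).trans (union_subset h3 ?_)
    exact (tsupport_mul_subset_right (f := fun _ => m)).trans hχ.2.2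
  -- Subtracting `m χ` from `ψ` makes the integral vanish, so that the difference is a derivative.
  obtain ⟨hθ, hθ'⟩ := isTestFun_primitive hT hρ (by
    rw [integral_sub (hi _ hψ) ((hi _ hχ).const_mul m), integral_const_mul, hχ1, mul_one, sub_self])
  have h4 := h _ hθ
  rw [hθ'] at h4
  have hψw := integrableOn_smul_of_hasCompactSupport hw h1.continuous h2
  have hχw := integrableOn_smul_of_hasCompactSupport hw hχ.1.continuous hχ.2.1
  have h5 : ∫ t in Ioo 0 T, (ψ t - m * χ t) • w t = (∫ t in Ioo 0 T, ψ t • w t) - m • c := by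
    have h7 : IntegrableOn (fun t => m • χ t • w t) (Ioo 0 T) := Integrable.smul m hχw
    rw [hc, ← integral_smul, ← integral_sub hψw h7]
    simp only [sub_smul, mul_smul]
  have h6 : ∫ t in Ioo 0 T, ψ t • (w t - c) = (∫ t in Ioo 0 T, ψ t • w t) - m • c := by
    rw [hm, ← integral_smul_const, ← integral_sub hψw ((hi _ hψ).smul_const c)]
    simp only [smul_sub]
  rw [h6, ← h5, h4]

/-- A function with an integrable weak derivative is, up to a constant, the primitive of that
derivative. -/
theorem HasWeakTimeDeriv.ae_eq_const_add_primitive {T : ℝ} (hT : 0 < T) {u u' : ℝ → X}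
    (hu : IntegrableOn u (Ioo 0 T)) (hu' : IntegrableOn u' (Ioo 0 T))
    (h : HasWeakTimeDeriv T u u') :
    ∃ c : X, ∀ᵐ t ∂(volume.restrict (Ioo 0 T)), u t = c + ∫ s in (0 : ℝ)..t, u' s := by
  have hp : IntegrableOn (fun t => ∫ s in (0 : ℝ)..t, u' s) (Ioo 0 T) := by
    have h1 : IntegrableOn u' (uIcc 0 T) := by
      rw [uIcc_of_le hT.le]
      exact (integrableOn_Icc_iff_integrableOn_Ioo).2 hu'
    have h2 := intervalIntegral.continuousOn_primitive_interval h1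
    rw [uIcc_of_le hT.le] at h2
    exact (h2.integrableOn_compact isCompact_Icc).mono_set Ioo_subset_Icc_self
  obtain ⟨c, hc⟩ := ae_eq_const_of_integral_deriv_smul_eq_zero hT (hu.sub hp) (by
    intro θ hθ
    obtain ⟨hd, hd', h0, hT0, hprim⟩ := hθ.deriv_props
    have h1 := integral_primitive_add_integral_primitive (T := T)
      (ContinuousLinearMap.lsmul ℝ ℝ (E := X)).flip hu'
      (hd.integrable_of_hasCompactSupport hd').integrableOn
    simp only [ContinuousLinearMap.flip_apply, ContinuousLinearMap.lsmul_apply, hprim,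
      integral_Ioo_eq_intervalIntegral (deriv θ) hT, hT0, zero_smul] at h1
    have h2 := h θ hθ
    simp only [Pi.sub_apply, smul_sub]
    rw [integral_sub (integrableOn_smul_of_hasCompactSupport hu hd hd')
      (integrableOn_smul_of_hasCompactSupport hp hd hd'), h2, eq_neg_of_add_eq_zero_left h1,
      sub_self])
  refine ⟨c, ?_⟩
  filter_upwards [hc] with t ht
  rw [← ht]
  simp

end TimeDeriv

/-! ### Regularization in a pair of Hilbert spaces -/

section Regularization

open Filter Topology

variable {H L : Type*} [NormedAddCommGroup H] [InnerProductSpace ℝ H] [CompleteSpace H]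
  [NormedAddCommGroup L] [InnerProductSpace ℝ L] [CompleteSpace L]

theorem tendsto_id_of_dense {G : Type*} [NormedAddCommGroup G] [NormedSpace ℝ G] {A : ℕ → G →L[ℝ] G}
    (hA : ∀ n x, ‖A n x‖ ≤ ‖x‖) {s : Set G} (hs : Dense s)
    (h : ∀ x ∈ s, Tendsto (fun n => A n x) atTop (𝓝 x)) (x : G) :
    Tendsto (fun n => A n x) atTop (𝓝 x) := by
  rw [Metric.tendsto_atTop]
  intro ε hε
  obtain ⟨y, hy, hxy⟩ := hs.exists_dist_lt x (show 0 < ε / 3 by positivity)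
  obtain ⟨n₀, hn₀⟩ := Metric.tendsto_atTop.1 (h y hy) (ε / 3) (by positivity)
  refine ⟨n₀, fun n hn => ?_⟩
  have h1 : dist (A n x) (A n y) ≤ dist x y := by
    rw [dist_eq_norm, dist_eq_norm, ← map_sub]
    exact hA n _
  have h2 := hn₀ n hn
  have h3 := dist_triangle4 (A n x) (A n y) y x
  rw [dist_comm y x] at h3
  linarith

/-- The Tikhonov regularization `(ε + j* j)⁻¹ j*` of the inverse of `j`, in its weak form. -/
theorem exists_tikhonov (j : H →L[ℝ] L) {ε : ℝ} (hε : 0 < ε) :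
    ∃ K : L →L[ℝ] H, ∀ l y, ε * inner ℝ (K l) y + inner ℝ (j (K l)) (j y) = inner ℝ l (j y) := by
  let b : H →L[ℝ] H →L[ℝ] ℝ := ε • innerSL ℝ + (innerSL ℝ).bilinearComp j j
  have hb : ∀ x y, b x y = ε * inner ℝ x y + inner ℝ (j x) (j y) := fun x y => rfl
  have hc : IsCoercive b := by
    refine ⟨ε, hε, fun x => ?_⟩
    rw [hb, real_inner_self_eq_norm_mul_norm, real_inner_self_eq_norm_mul_norm]
    nlinarith [mul_self_nonneg ‖j x‖]
  let e := hc.continuousLinearEquivOfBilin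
  refine ⟨(e.symm : H →L[ℝ] H).comp j.adjoint, fun l y => ?_⟩
  have h := hc.continuousLinearEquivOfBilin_apply (e.symm (j.adjoint l)) y
  rw [hb] at h
  have h2 : hc.continuousLinearEquivOfBilin (e.symm (j.adjoint l)) = j.adjoint l :=
    e.apply_symm_apply _
  rw [h2, ContinuousLinearMap.adjoint_inner_left] at h
  exact h.symm

/-- If `j : H → L` is injective with dense range, then there are bounded operators `K n : L → H`
such that `j (K n)` and `(K n) j` are contractions that converge strongly to the identity. -/
theorem exists_regularization (j : H →L[ℝ] L) (hinj : Function.Injective j)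
    (hden : DenseRange j) :
    ∃ K : ℕ → L →L[ℝ] H, (∀ n l, ‖j (K n l)‖ ≤ ‖l‖) ∧ (∀ n h, ‖K n (j h)‖ ≤ ‖h‖) ∧
      (∀ l, Tendsto (fun n => j (K n l)) atTop (𝓝 l)) ∧
      (∀ h, Tendsto (fun n => K n (j h)) atTop (𝓝 h)) := by
  let ε : ℕ → ℝ := fun n => 1 / ((n : ℝ) + 1)
  have hε : ∀ n, 0 < ε n := fun n => Nat.one_div_pos_of_nat
  have hε0 : Tendsto ε atTop (𝓝 0) := tendsto_one_div_add_atTop_nhds_zero_nat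
  choose K hK using fun n => exists_tikhonov j (hε n)
  have hL : ∀ n l, ‖j (K n l)‖ ≤ ‖l‖ := by
    intro n l
    have h1 := hK n l (K n l)
    rw [real_inner_self_eq_norm_mul_norm, real_inner_self_eq_norm_mul_norm] at h1
    have h2 := real_inner_le_norm l (j (K n l))
    have h3 : 0 ≤ ε n * (‖K n l‖ * ‖K n l‖) := by have := hε n; positivity
    by_contra! h4
    nlinarith [norm_nonneg l, norm_nonneg (j (K n l))]
  -- The remainder `r = h - K (j h)` satisfies `ε ⟨h, r⟩ = ε ‖r‖² + ‖j r‖²`.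
  have hr : ∀ n h, ε n * inner ℝ h (h - K n (j h)) =
      ε n * ‖h - K n (j h)‖ ^ 2 + ‖j (h - K n (j h))‖ ^ 2 := by
    intro n h
    have h1 := hK n (j h) (h - K n (j h))
    rw [← real_inner_self_eq_norm_sq, ← real_inner_self_eq_norm_sq]
    have h2 : inner ℝ (h - K n (j h)) (h - K n (j h)) =
      inner ℝ h (h - K n (j h)) - inner ℝ (K n (j h)) (h - K n (j h)) := inner_sub_left _ _ _
    have h3 : inner ℝ (j (h - K n (j h))) (j (h - K n (j h))) =
      inner ℝ (j h) (j (h - K n (j h))) - inner ℝ (j (K n (j h))) (j (h - K n (j h))) := by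
      rw [← inner_sub_left, ← map_sub]
    rw [h2, h3]
    linarith
  have hr1 : ∀ n h, ‖h - K n (j h)‖ ^ 2 ≤ inner ℝ h (h - K n (j h)) := by
    intro n h
    have h1 := hr n h
    have h2 := sq_nonneg ‖j (h - K n (j h))‖
    exact le_of_mul_le_mul_left (by linarith) (hε n)
  have hr2 : ∀ n h, ‖h - K n (j h)‖ ≤ ‖h‖ := by
    intro n h
    have h1 := (hr1 n h).trans (real_inner_le_norm _ _)
    by_contra! h4
    nlinarith [norm_nonneg h]
  have hr3 : ∀ n h, ‖j (h - K n (j h))‖ ^ 2 ≤ ε n * ‖h‖ ^ 2 := by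
    intro n h
    have h1 := hr n h
    have h2 : inner ℝ h (h - K n (j h)) ≤ ‖h‖ ^ 2 := by
      refine (real_inner_le_norm _ _).trans ?_
      rw [sq]
      gcongr
      exact hr2 n h
    have h3 := mul_le_mul_of_nonneg_left h2 (hε n).le
    have h4 : 0 ≤ ε n * ‖h - K n (j h)‖ ^ 2 := by have := hε n; positivity
    linarith
  have hr4 : ∀ h, Tendsto (fun n => ‖j (h - K n (j h))‖) atTop (𝓝 0) := by
    intro h
    have h1 : Tendsto (fun n => ε n * ‖h‖ ^ 2) atTop (𝓝 0) := by
      simpa using hε0.mul_const (‖h‖ ^ 2)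
    have h2 := squeeze_zero (fun n => sq_nonneg _) (fun n => hr3 n h) h1
    simpa using h2.sqrt
  have hH : ∀ n h, ‖K n (j h)‖ ≤ ‖h‖ := by
    intro n h
    have h1 : ‖K n (j h)‖ ^ 2 = ‖h‖ ^ 2 - 2 * inner ℝ h (h - K n (j h)) + ‖h - K n (j h)‖ ^ 2 := by
      rw [← norm_sub_sq_real, sub_sub_cancel]
    have h2 := hr1 n h
    refine le_of_sq_le_sq ?_ (norm_nonneg _)
    nlinarith [sq_nonneg ‖h - K n (j h)‖]
  refine ⟨K, hL, hH, ?_, ?_⟩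
  · refine tendsto_id_of_dense (A := fun n => j.comp (K n)) hL hden ?_
    rintro _ ⟨h, rfl⟩
    rw [tendsto_iff_norm_sub_tendsto_zero]
    refine (hr4 h).congr fun n => ?_
    rw [map_sub, norm_sub_rev]
    rfl
  -- For `h = j* k` the remainder satisfies `‖r‖² ≤ ⟨j* k, r⟩ = ⟨k, j r⟩ → 0`, and such `h` are
  -- dense.
  · have hden' : Dense (range j.adjoint) := by
      have h1 : (j.adjoint.range)ᗮ = ⊥ := by
        rw [ContinuousLinearMap.orthogonal_range, ContinuousLinearMap.adjoint_adjoint]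
        exact LinearMap.ker_eq_bot.2 hinj
      have h2 := (Submodule.topologicalClosure_eq_top_iff (K := j.adjoint.range)).2 h1
      exact (Submodule.dense_iff_topologicalClosure_eq_top).2 h2
    refine tendsto_id_of_dense (A := fun n => (K n).comp j) hH hden' ?_
    rintro _ ⟨k, rfl⟩
    rw [tendsto_iff_norm_sub_tendsto_zero]
    have h1 : Tendsto (fun n => ‖k‖ * ‖j (j.adjoint k - K n (j (j.adjoint k)))‖) atTop (𝓝 0) := by
      simpa using (hr4 (j.adjoint k)).const_mul ‖k‖
    have h2 := squeeze_zero (fun n => sq_nonneg _) (fun n => (hr1 n (j.adjoint k)).trans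
      (by rw [ContinuousLinearMap.adjoint_inner_left]; exact real_inner_le_norm _ _)) h1
    have h3 : Tendsto (fun n => ‖j.adjoint k - K n (j (j.adjoint k))‖) atTop (𝓝 0) := by
      simpa using h2.sqrt
    refine h3.congr fun n => ?_
    rw [norm_sub_rev]
    rfl

end Regularization

/-! ### Weak derivatives in the dual space and integration by parts -/

section Duality

open Filter Topology

variable {H L : Type*} [NormedAddCommGroup H] [InnerProductSpace ℝ H]
  [NormedAddCommGroup L] [InnerProductSpace ℝ L]

theorem MemL2Time.integrableOn {X : Type*} [NormedAddCommGroup X] {T : ℝ} {u : ℝ → X}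
    (hu : MemLp u 2 (volume.restrict (Ioo 0 T))) : IntegrableOn u (Ioo 0 T) :=
  hu.integrable one_le_two

/-- An element of `H¹₀(0,T;X)` is the primitive from `0` of its derivative, whose integral over
`(0,T)` vanishes. -/
theorem MemH10Time.ae_eq_primitive {X : Type*} [NormedAddCommGroup X] [NormedSpace ℝ X]
    [CompleteSpace X] {T : ℝ} (hT : 0 < T) {q q' : ℝ → X} (h : MemH10Time T q q') :
    (∀ᵐ t ∂(volume.restrict (Ioo 0 T)), q t = ∫ s in (0 : ℝ)..t, q' s) ∧
      ∫ t in Ioo 0 T, q' t = 0 := by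
  obtain ⟨hq, hq', hder, c, ⟨hc, hcq⟩, hc0, hcT⟩ := h
  have hi := MemL2Time.integrableOn hq'
  obtain ⟨d, hd⟩ := hder.ae_eq_const_add_primitive hT (MemL2Time.integrableOn hq) hi
  have hcont : ContinuousOn (fun t => ∫ s in (0 : ℝ)..t, q' s) (Icc 0 T) := by
    have h1 : IntegrableOn q' (uIcc 0 T) := by
      rw [uIcc_of_le hT.le]
      exact (integrableOn_Icc_iff_integrableOn_Ioo).2 hi
    have h2 := intervalIntegral.continuousOn_primitive_interval h1
    rwa [uIcc_of_le hT.le] at h2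
  have heq : EqOn c (fun t => d + ∫ s in (0 : ℝ)..t, q' s) (Icc 0 T) := by
    refine Measure.eqOn_Icc_of_ae_eq volume hT.ne ?_ hc (continuousOn_const.add hcont)
    rw [Measure.restrict_congr_set Ioo_ae_eq_Icc.symm]
    exact hcq.trans hd
  have hd0 : d = 0 := by
    have h1 := heq (left_mem_Icc.2 hT.le)
    simpa [hc0] using h1.symm
  refine ⟨?_, ?_⟩
  · filter_upwards [hd] with t ht
    simpa [hd0] using ht
  · have h1 := heq (right_mem_Icc.2 hT.le)
    rw [integral_Ioo_eq_intervalIntegral _ hT]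
    simpa [hcT, hd0] using h1.symm

theorem integrableOn_innerSL_comp {T : ℝ} (j : H →L[ℝ] L) {u : ℝ → L} (hu : MemL2Time T u) :
    IntegrableOn (fun t => (innerSL ℝ (u t)).comp j) (Ioo 0 T) := by
  have h : Integrable (fun t => (((ContinuousLinearMap.compL ℝ H L ℝ).flip j).comp
      (innerSL ℝ (E := L))) (u t)) (volume.restrict (Ioo 0 T)) :=
    ContinuousLinearMap.integrable_comp _ (MemL2Time.integrableOn hu)
  exact h

theorem integrable_apply_of_memLp {α : Type*} [MeasurableSpace α] {μ : Measure α}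
    {F : α → StrongDual ℝ H} {ξ : α → H} (hF : MemLp F 2 μ) (hξ : MemLp ξ 2 μ) :
    Integrable (fun t => F t (ξ t)) μ := by
  refine (hF.norm.integrable_mul hξ.norm).mono' ?_ (.of_forall fun t => (F t).le_opNorm _)
  exact isBoundedBilinearMap_apply.continuous.comp_aestronglyMeasurable (hF.1.prodMk hξ.1)

theorem integrable_inner_of_memLp {α : Type*} [MeasurableSpace α] {μ : Measure α}
    {u ξ : α → L} (hu : MemLp u 2 μ) (hξ : MemLp ξ 2 μ) :
    Integrable (fun t => inner ℝ (u t) (ξ t)) μ :=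
  (hu.norm.integrable_mul hξ.norm).mono' (hu.1.inner hξ.1)
    (.of_forall fun _ => norm_inner_le_norm _ _)

variable [CompleteSpace H] [CompleteSpace L]

/-- Integration by parts against `ξ ∈ L²(0,T;H)` with `ξ' ∈ L²(0,T;L)` vanishing at the end points,
for `u ∈ L²(0,T;L)` with weak derivative `F ∈ L²(0,T;H*)`. Neither `u` nor `ξ'` takes values in `H`,
so `ξ` is first replaced by `K n (j ξ)`, an element of `H¹₀(0,T;H)`. -/
theorem integral_inner_eq_neg_integral_apply {T : ℝ} (hT : 0 < T) (j : H →L[ℝ] L)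
    (hinj : Function.Injective j) (hden : DenseRange j) {u : ℝ → L} {F : ℝ → StrongDual ℝ H}
    (hu : MemL2Time T u) (hF : MemL2Time T F)
    (hder : HasWeakTimeDeriv T (fun t => (innerSL ℝ (u t)).comp j) F)
    {ξ : ℝ → H} {ξ' : ℝ → L} (hξ : MemL2Time T ξ) (hq : MemH10Time T (fun t => j (ξ t)) ξ') :
    ∫ t in Ioo 0 T, inner ℝ (u t) (ξ' t) = -∫ t in Ioo 0 T, F t (ξ t) := by
  have hξ' : MemL2Time T ξ' := hq.2.1
  obtain ⟨hprim, hint⟩ := hq.ae_eq_primitive hT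
  have hui := integrableOn_innerSL_comp j hu
  obtain ⟨c, hc⟩ := hder.ae_eq_const_add_primitive hT hui (MemL2Time.integrableOn hF)
  obtain ⟨K, hKL, hKH, hKL', hKH'⟩ := exists_regularization j hinj hden
  have hn : ∀ n, ∫ t in Ioo 0 T, inner ℝ (u t) (j (K n (ξ' t)))
      = -∫ t in Ioo 0 T, F t (K n (j (ξ t))) := by
    intro n
    have h1 := integral_primitive_add_integral_primitive (T := T)
      ((ContinuousLinearMap.compL ℝ L H ℝ).flip (K n)) (MemL2Time.integrableOn hF)
      (MemL2Time.integrableOn hξ')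
    simp only [ContinuousLinearMap.flip_apply, ContinuousLinearMap.compL_apply,
      ContinuousLinearMap.comp_apply, hint, map_zero] at h1
    have h2 : ∫ t in Ioo 0 T, F t (K n (∫ s in (0 : ℝ)..t, ξ' s))
        = ∫ t in Ioo 0 T, F t (K n (j (ξ t))) := by
      refine integral_congr_ae ?_
      filter_upwards [hprim] with t ht
      rw [ht]
    have h3 : ∫ t in Ioo 0 T, (∫ s in (0 : ℝ)..t, F s) (K n (ξ' t))
        = ∫ t in Ioo 0 T, (inner ℝ (u t) (j (K n (ξ' t))) - (c.comp (K n)) (ξ' t)) := by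
      refine integral_congr_ae ?_
      filter_upwards [hc] with t ht
      have h5 : inner ℝ (u t) (j (K n (ξ' t)))
          = c (K n (ξ' t)) + (∫ s in (0 : ℝ)..t, F s) (K n (ξ' t)) :=
        congrArg (fun A : StrongDual ℝ H => A (K n (ξ' t))) ht
      rw [h5]
      simp
    have h4 : ∫ t in Ioo 0 T, (c.comp (K n)) (ξ' t) = 0 := by
      rw [ContinuousLinearMap.integral_comp_comm _ (MemL2Time.integrableOn hξ'), hint, map_zero]
    have h6 : Integrable (fun t => inner ℝ (u t) (j (K n (ξ' t)))) (volume.restrict (Ioo 0 T)) :=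
      integrable_inner_of_memLp hu ((j.comp (K n)).comp_memLp' hξ')
    rw [integral_sub h6 ((c.comp (K n)).integrable_comp (MemL2Time.integrableOn hξ')), h4,
      sub_zero] at h3
    rw [← h2, ← h3]
    exact eq_neg_of_add_eq_zero_left h1
  have hlim1 : Tendsto (fun n => ∫ t in Ioo 0 T, inner ℝ (u t) (j (K n (ξ' t)))) atTop
      (𝓝 (∫ t in Ioo 0 T, inner ℝ (u t) (ξ' t))) := by
    refine tendsto_integral_of_dominated_convergence (fun t => ‖u t‖ * ‖ξ' t‖) (fun n => ?_)
      (hu.norm.integrable_mul hξ'.norm) (fun n => .of_forall fun t => ?_) (.of_forall fun t => ?_)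
    · exact hu.1.inner ((j.comp (K n)).continuous.comp_aestronglyMeasurable hξ'.1)
    · exact (norm_inner_le_norm _ _).trans (by gcongr; exact hKL n _)
    · exact tendsto_const_nhds.inner (hKL' _)
  have hlim2 : Tendsto (fun n => -∫ t in Ioo 0 T, F t (K n (j (ξ t)))) atTop
      (𝓝 (-∫ t in Ioo 0 T, F t (ξ t))) := by
    refine (tendsto_integral_of_dominated_convergence (fun t => ‖F t‖ * ‖ξ t‖) (fun n => ?_)
      (hF.norm.integrable_mul hξ.norm) (fun n => .of_forall fun t => ?_)
      (.of_forall fun t => ?_)).neg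
    · exact isBoundedBilinearMap_apply.continuous.comp_aestronglyMeasurable
        (hF.1.prodMk (((K n).comp j).continuous.comp_aestronglyMeasurable hξ.1))
    · exact ((F t).le_opNorm _).trans (by gcongr; exact hKH n _)
    · exact ((F t).continuous.tendsto _).comp (hKH' _)
  simp only [hn] at hlim1
  exact tendsto_nhds_unique hlim1 hlim2

/-- The functions `θ(t) φ` are admissible in the integrated identity. -/
theorem memH10Time_smul {T : ℝ} {θ : ℝ → ℝ} (hθ : IsTestFun (Ioo 0 T) θ) (w : L) :
    MemH10Time T (fun t => θ t • w) (fun t => deriv θ t • w) := by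
  obtain ⟨hd, hd', h0, hT0, -⟩ := hθ.deriv_props
  have hm : ∀ ρ : ℝ → ℝ, Continuous ρ → HasCompactSupport ρ →
      MemL2Time T (fun t => ρ t • w) := by
    intro ρ hρ hρ'
    have hc : Continuous fun t => ρ t • w := hρ.smul continuous_const
    obtain ⟨C, hC⟩ := (hρ'.smul_right (f' := fun _ : ℝ => w)).exists_bound_of_continuous hc
    exact MemLp.of_bound hc.aestronglyMeasurable C (.of_forall hC)
  refine ⟨hm _ hθ.1.continuous hθ.2.1, hm _ hd hd', ?_, fun t => θ t • w,
    ⟨(hθ.1.continuous.smul continuous_const).continuousOn, .rfl⟩, by simp [h0], by simp [hT0]⟩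
  intro η hη
  have hηd : Continuous (deriv η) := hη.1.continuous_deriv (by simp)
  have hdiff : ∀ ρ : ℝ → ℝ, IsTestFun (Ioo 0 T) ρ → ∀ t, HasDerivAt ρ (deriv ρ t) t := fun ρ hρ t =>
    ((hρ.1.differentiable (by simp)).differentiableAt).hasDerivAt
  have h1 : ∫ t in Ioo 0 T, (deriv η t * θ t + η t * deriv θ t) = 0 := by
    have hp : IsTestFun (Ioo 0 T) (fun t => η t * θ t) :=
      ⟨hη.1.mul hθ.1, hη.2.1.mul_right, tsupport_mul_subset_left.trans hη.2.2⟩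
    obtain ⟨-, -, -, hpT, hprim⟩ := hp.deriv_props
    have h2 : deriv (fun t => η t * θ t) = fun t => deriv η t * θ t + η t * deriv θ t :=
      funext fun t => ((hdiff η hη t).mul (hdiff θ hθ t)).deriv
    rcases le_or_gt T 0 with h | h
    · simp [Ioo_eq_empty (not_lt.2 h)]
    · rw [integral_Ioo_eq_intervalIntegral _ h, ← h2, hprim, hpT]
  have hi1 : Integrable (fun t => deriv η t * θ t) (volume.restrict (Ioo 0 T)) :=
    ((hηd.mul hθ.1.continuous).integrable_of_hasCompactSupport hθ.2.1.mul_left).integrableOn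
  have hi2 : Integrable (fun t => η t * deriv θ t) (volume.restrict (Ioo 0 T)) :=
    ((hη.1.continuous.mul hd).integrable_of_hasCompactSupport hd'.mul_left).integrableOn
  rw [integral_add hi1 hi2] at h1
  simp only [← mul_smul]
  rw [integral_smul_const, integral_smul_const, eq_neg_of_add_eq_zero_left h1, neg_smul]

/-- For `u ∈ L²(0,T;L)` and `F ∈ L²(0,T;H*)`, the function `F` is the weak derivative of `u` in `H*`
if and only if the integration by parts formula holds for all `ξ ∈ L²(0,T;H) ∩ H¹₀(0,T;L)`. -/
theorem hasWeakTimeDeriv_iff {T : ℝ} (hT : 0 < T) (j : H →L[ℝ] L)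
    (hinj : Function.Injective j) (hden : DenseRange j) {u : ℝ → L} {F : ℝ → StrongDual ℝ H}
    (hu : MemL2Time T u) (hF : MemL2Time T F) :
    HasWeakTimeDeriv T (fun t => (innerSL ℝ (u t)).comp j) F ↔
      ∀ (ξ : ℝ → H) (ξ' : ℝ → L), MemL2Time T ξ → MemH10Time T (fun t => j (ξ t)) ξ' →
        ∫ t in Ioo 0 T, inner ℝ (u t) (ξ' t) = -∫ t in Ioo 0 T, F t (ξ t) := by
  refine ⟨fun h ξ ξ' hξ hq => integral_inner_eq_neg_integral_apply hT j hinj hden hu hF h hξ hq,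
    fun h θ hθ => ?_⟩
  obtain ⟨hd, hd', -, -, -⟩ := hθ.deriv_props
  have hui := integrableOn_innerSL_comp j hu
  ext φ
  rw [neg_apply,
    ContinuousLinearMap.integral_apply (integrableOn_smul_of_hasCompactSupport hui hd hd') φ,
    ContinuousLinearMap.integral_apply (integrableOn_smul_of_hasCompactSupport
      (MemL2Time.integrableOn hF) hθ.1.continuous hθ.2.1) φ]
  have h1 := h (fun t => θ t • φ) (fun t => deriv θ t • j φ) (memH10Time_smul hθ φ).1
    (by simpa only [map_smul] using memH10Time_smul hθ (j φ))
  simpa [inner_smul_right] using h1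

end Duality

/-! ### The Sobolev space and the weak divergence -/

section Sobolev

variable {N : ℕ} {Ω : Set (E N)}

instance fact_two_ne_top : Fact ((2 : ℝ≥0∞) ≠ ⊤) := ⟨by simp⟩

instance secondCountable_H10 : SecondCountableTopology (H10 Ω) := by
  have h1 : SecondCountableTopology (L2 Ω) := inferInstance
  have h2 : SecondCountableTopology (L2vec Ω) := inferInstance
  exact TopologicalSpace.Subtype.secondCountableTopology _

theorem gradient_apply {φ : E N → ℝ} (x : E N) (i : Fin N) :
    gradient φ x i = fderiv ℝ φ x (EuclideanSpace.single i 1) := by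
  rw [← inner_gradient_left, EuclideanSpace.inner_single_right]
  simp

theorem IsTestFun.continuous_gradient {φ : E N → ℝ} (hφ : IsTestFun Ω φ) :
    Continuous (gradient φ) :=
  (InnerProductSpace.toDual ℝ (E N)).symm.continuous.comp
    (hφ.1.continuous_fderiv (by simp))

theorem IsTestFun.hasCompactSupport_gradient {φ : E N → ℝ} (hφ : IsTestFun Ω φ) :
    HasCompactSupport (gradient φ) :=
  (hφ.2.1.fderiv (𝕜 := ℝ)).comp_left (g := (InnerProductSpace.toDual ℝ (E N)).symm) (map_zero _)

/-- A linear identity in `(u, ∇u)` that holds for test functions holds in `H¹₀(Ω)`. -/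
theorem H10.inner_add_inner_eq_zero (m : L2 Ω) (G : L2vec Ω)
    (h : ∀ φ : E N → ℝ, IsTestFun Ω φ →
      (∫ x in Ω, φ x * m x) + ∫ x in Ω, inner ℝ (G x) (gradient φ x) = 0) (u : H10 Ω) :
    inner ℝ m (H10.toL2 u) + inner ℝ G (H10.grad u) = 0 := by
  let Λ : WithLp 2 (L2 Ω × L2vec Ω) →L[ℝ] ℝ :=
    (innerSL ℝ m).comp (WithLp.fstL 2 ℝ (L2 Ω) (L2vec Ω)) +
      (innerSL ℝ G).comp (WithLp.sndL 2 ℝ (L2 Ω) (L2vec Ω))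
  have hle : (testGraph Ω).topologicalClosure ≤ Λ.ker := by
    refine Submodule.topologicalClosure_minimal _ ?_ Λ.isClosed_ker
    refine Submodule.span_le.2 ?_
    rintro p ⟨φ, hφ, h1, h2⟩
    have h3 : Λ p = inner ℝ m p.fst + inner ℝ G p.snd := rfl
    change Λ p = 0
    rw [h3, L2.inner_def, L2.inner_def, ← h φ hφ]
    congr 1
    · refine integral_congr_ae ?_
      filter_upwards [h1] with x hx
      rw [hx]
      simp
    · refine integral_congr_ae ?_
      filter_upwards [h2] with x hx
      rw [hx]
  exact hle u.2

theorem setIntegral_eq_integral_of_tsupport_subset {X : Type*} [NormedAddCommGroup X]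
    [NormedSpace ℝ X] {ψ : E N → ℝ} (hψ : tsupport ψ ⊆ Ω)
    {F : E N → X} (hF : ∀ x, x ∉ tsupport ψ → F x = 0) :
    ∫ x in Ω, F x = ∫ x, F x :=
  setIntegral_eq_integral_of_forall_compl_eq_zero fun x hx => hF x fun h => hx (hψ h)

/-- Integration by parts of a Lipschitz function against the product of two test functions. -/
theorem integral_lipschitz_mul_test {f : E N → ℝ} {K : ℝ≥0} (hf : LipschitzWith K f)
    {φ ψ : E N → ℝ} (hφ : IsTestFun Ω φ) (hψ : IsTestFun Ω ψ) (i : Fin N) :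
    (∫ x in Ω, φ x * (f x * gradient ψ x i
        + lineDeriv ℝ f x (EuclideanSpace.single i 1) * ψ x))
      + ∫ x in Ω, gradient φ x i * (f x * ψ x) = 0 := by
  set e : E N := EuclideanSpace.single i 1
  have hp : ContDiff ℝ ∞ (fun x => φ x * ψ x) := hφ.1.mul hψ.1
  have hpc : HasCompactSupport (fun x => φ x * ψ x) := hψ.2.1.mul_left
  obtain ⟨C, hC⟩ := hp.lipschitzWith_of_hasCompactSupport hpc (by simp)
  have h1 := hf.integral_lineDeriv_mul_eq (μ := volume) hC hpc e
  have hdφ : ∀ x, DifferentiableAt ℝ φ x := fun x =>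
    (hφ.1.differentiable (by simp)).differentiableAt
  have hdψ : ∀ x, DifferentiableAt ℝ ψ x := fun x =>
    (hψ.1.differentiable (by simp)).differentiableAt
  have h2 : ∀ x, lineDeriv ℝ (fun x => φ x * ψ x) x (-e)
      = -(gradient φ x i * ψ x + φ x * gradient ψ x i) := by
    intro x
    rw [lineDeriv_neg, ((hdφ x).fun_mul (hdψ x)).lineDeriv_eq_fderiv,
      fderiv_fun_mul (hdφ x) (hdψ x), gradient_apply, gradient_apply]
    simp only [add_apply, smul_apply, smul_eq_mul]
    ring
  simp only [h2] at h1
  have hsψ : ∀ x, x ∉ tsupport ψ → ψ x = 0 := fun x hx => image_eq_zero_of_notMem_tsupport hx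
  have hgψ : ∀ x, x ∉ tsupport ψ → gradient ψ x i = 0 := by
    intro x hx
    rw [gradient_apply, fderiv_of_notMem_tsupport ℝ hx, zero_apply]
  rw [setIntegral_eq_integral_of_tsupport_subset hψ.2.2 (fun x hx => by simp [hsψ x hx, hgψ x hx]),
    setIntegral_eq_integral_of_tsupport_subset hψ.2.2 (fun x hx => by simp [hsψ x hx])]
  have hcφ : Continuous fun x => gradient φ x i :=
    (EuclideanSpace.proj i).continuous.comp hφ.continuous_gradient
  have hcψ : Continuous fun x => gradient ψ x i :=
    (EuclideanSpace.proj i).continuous.comp hψ.continuous_gradient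
  have i1 : Integrable (fun x => lineDeriv ℝ f x e * (φ x * ψ x)) := by
    refine Integrable.bdd_mul (c := K * ‖e‖) ?_
      (measurable_lineDeriv hf.continuous).aestronglyMeasurable
      (.of_forall fun x => norm_lineDeriv_le_of_lipschitz ℝ hf)
    exact hp.continuous.integrable_of_hasCompactSupport hpc
  have i2 : Integrable (fun x => φ x * (f x * gradient ψ x i)) :=
    (hφ.1.continuous.mul (hf.continuous.mul hcψ)).integrable_of_hasCompactSupport hφ.2.1.mul_right
  have i3 : Integrable (fun x => gradient φ x i * (f x * ψ x)) :=
    (hcφ.mul (hf.continuous.mul hψ.1.continuous)).integrable_of_hasCompactSupport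
      hψ.2.1.mul_left.mul_left
  have h3 : ∫ x, φ x * (f x * gradient ψ x i + lineDeriv ℝ f x e * ψ x)
      = (∫ x, φ x * (f x * gradient ψ x i)) + ∫ x, lineDeriv ℝ f x e * (φ x * ψ x) := by
    rw [← integral_add i2 i1]
    refine integral_congr_ae (.of_forall fun x => ?_)
    simp only
    ring
  have h4 : ∫ x, -(gradient φ x i * ψ x + φ x * gradient ψ x i) * f x
      = -((∫ x, φ x * (f x * gradient ψ x i)) + ∫ x, gradient φ x i * (f x * ψ x)) := by
    rw [← integral_add i2 i3, ← integral_neg]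
    refine integral_congr_ae (.of_forall fun x => ?_)
    simp only
    ring
  rw [h3, h1, h4]
  ring

/-- Integration by parts of a Lipschitz function against an element of `H¹₀(Ω)` and a test
function. -/
theorem H10.integral_lipschitz_mul {f : E N → ℝ} {K : ℝ≥0} (hf : LipschitzWith K f)
    {ψ : E N → ℝ} (hψ : IsTestFun Ω ψ) (i : Fin N) (u : H10 Ω) :
    (∫ x in Ω, H10.toL2 u x * (f x * gradient ψ x i
        + lineDeriv ℝ f x (EuclideanSpace.single i 1) * ψ x))
      + ∫ x in Ω, H10.grad u x i * (f x * ψ x) = 0 := by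
  set e : E N := EuclideanSpace.single i 1 with he
  have hcψ : Continuous fun x => gradient ψ x i :=
    (EuclideanSpace.proj i).continuous.comp hψ.continuous_gradient
  have hcs : HasCompactSupport fun x => gradient ψ x i :=
    hψ.hasCompactSupport_gradient.comp_left (g := fun y : E N => y i) rfl
  have hm : MemLp (fun x => f x * gradient ψ x i + lineDeriv ℝ f x e * ψ x) 2
      (volume.restrict Ω) := by
    refine MemLp.add ?_ ?_
    · exact ((hf.continuous.mul hcψ).memLp_of_hasCompactSupport hcs.mul_left).restrict _
    · have h1 : MemLp ψ 2 (volume.restrict Ω) :=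
        (hψ.1.continuous.memLp_of_hasCompactSupport hψ.2.1).restrict _
      refine h1.of_le_mul (c := K * ‖e‖) ?_ (.of_forall fun x => ?_)
      · exact ((measurable_lineDeriv hf.continuous).mul
          hψ.1.continuous.measurable).aestronglyMeasurable
      · rw [norm_mul]
        gcongr
        exact norm_lineDeriv_le_of_lipschitz ℝ hf
  have hG : MemLp (fun x => (f x * ψ x) • e) 2 (volume.restrict Ω) :=
    (((hf.continuous.mul hψ.1.continuous).smul continuous_const).memLp_of_hasCompactSupport
      (hψ.2.1.mul_left.smul_right)).restrict _
  have h := H10.inner_add_inner_eq_zero (hm.toLp _) (hG.toLp _) (by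
    intro φ hφ
    rw [← integral_lipschitz_mul_test hf hφ hψ i]
    congr 1
    · refine integral_congr_ae ?_
      filter_upwards [hm.coeFn_toLp] with x hx
      rw [hx]
    · refine integral_congr_ae ?_
      filter_upwards [hG.coeFn_toLp] with x hx
      rw [hx, real_inner_smul_left, EuclideanSpace.inner_single_left]
      simp
      ring) u
  rw [← h, L2.inner_def, L2.inner_def]
  congr 1
  · refine integral_congr_ae ?_
    filter_upwards [hm.coeFn_toLp] with x hx
    rw [hx]
    simp
  · refine integral_congr_ae ?_
    filter_upwards [hG.coeFn_toLp] with x hx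
    rw [hx, real_inner_smul_left, EuclideanSpace.inner_single_left]
    simp
    ring

theorem integrableOn_of_memLp_two {X : Type*} [NormedAddCommGroup X] {f : E N → X}
    (hf : MemLp f 2 (volume.restrict Ω)) (hΩb : Bornology.IsBounded Ω) :
    IntegrableOn f Ω := by
  have : IsFiniteMeasure (volume.restrict Ω) := ⟨by simpa using hΩb.measure_lt_top⟩
  exact hf.integrable one_le_two

/-- The weak gradient of an element of `H¹₀(Ω)` is determined by the function: integration by parts
against test functions, which is the case of the constant `1` in `H10.integral_lipschitz_mul`. -/
theorem H10.toL2_injective (hΩ : IsOpen Ω) (hΩb : Bornology.IsBounded Ω) :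
    Function.Injective (H10.toL2 (Ω := Ω)) := by
  rw [injective_iff_map_eq_zero]
  intro u hu
  have h0 : ∀ᵐ x ∂(volume.restrict Ω), H10.toL2 u x = 0 := by
    rw [hu]
    exact Lp.coeFn_zero _ _ _
  have hg : ∀ i : Fin N, ∀ᵐ x ∂(volume.restrict Ω), H10.grad u x i = 0 := by
    intro i
    rw [ae_restrict_iff' hΩ.measurableSet]
    have hint : IntegrableOn (fun x => H10.grad u x i) Ω :=
      (EuclideanSpace.proj (𝕜 := ℝ) i).integrable_comp
        (integrableOn_of_memLp_two (Lp.memLp (H10.grad u)) hΩb)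
    refine hΩ.ae_eq_zero_of_integral_contDiff_smul_eq_zero hint.locallyIntegrableOn ?_
    intro ψ h1 h2 h3
    have h4 := H10.integral_lipschitz_mul (LipschitzWith.const (1 : ℝ)) ⟨h1, h2, h3⟩ i u
    have h5 : ∫ x in Ω, H10.toL2 u x * (1 * gradient ψ x i
        + lineDeriv ℝ (fun _ : E N => (1 : ℝ)) x (EuclideanSpace.single i 1) * ψ x) = 0 := by
      refine integral_eq_zero_of_ae ?_
      filter_upwards [h0] with x hx
      simp [hx]
    rw [h5, zero_add] at h4
    rw [← setIntegral_eq_integral_of_tsupport_subset h3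
      (fun x hx => by rw [image_eq_zero_of_notMem_tsupport hx, zero_smul]), ← h4]
    refine integral_congr_ae (.of_forall fun x => ?_)
    simp [mul_comm]
  have hgrad : H10.grad u = 0 := by
    rw [Lp.eq_zero_iff_ae_eq_zero]
    filter_upwards [ae_all_iff.2 hg] with x hx
    ext i
    exact hx i
  refine Subtype.ext (WithLp.ofLp_injective 2 ?_)
  exact Prod.ext hu hgrad

theorem H10.exists_of_isTestFun {φ : E N → ℝ} (hφ : IsTestFun Ω φ) :
    ∃ u : H10 Ω, H10.toL2 u =ᵐ[volume.restrict Ω] φ := by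
  have h1 : MemLp φ 2 (volume.restrict Ω) :=
    (hφ.1.continuous.memLp_of_hasCompactSupport hφ.2.1).restrict _
  have h2 : MemLp (gradient φ) 2 (volume.restrict Ω) :=
    (hφ.continuous_gradient.memLp_of_hasCompactSupport hφ.hasCompactSupport_gradient).restrict _
  exact ⟨⟨WithLp.toLp 2 (h1.toLp _, h2.toLp _), Submodule.le_topologicalClosure _
    (Submodule.subset_span ⟨φ, hφ, h1.coeFn_toLp, h2.coeFn_toLp⟩)⟩, h1.coeFn_toLp⟩

/-- A function in `L²(Ω)` orthogonal to all test functions vanishes. -/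
theorem H10.denseRange_toL2 (hΩ : IsOpen Ω) (hΩb : Bornology.IsBounded Ω) :
    DenseRange (H10.toL2 (Ω := Ω)) := by
  have h : (H10.toL2 (Ω := Ω)).rangeᗮ = ⊥ := by
    rw [Submodule.eq_bot_iff]
    intro w hw
    rw [Lp.eq_zero_iff_ae_eq_zero]
    refine (ae_restrict_iff' hΩ.measurableSet).2 ?_
    refine hΩ.ae_eq_zero_of_integral_contDiff_smul_eq_zero
      (integrableOn_of_memLp_two (Lp.memLp w) hΩb).locallyIntegrableOn ?_
    intro ψ h1 h2 h3
    obtain ⟨u, hu⟩ := H10.exists_of_isTestFun (Ω := Ω) ⟨h1, h2, h3⟩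
    rw [← setIntegral_eq_integral_of_tsupport_subset h3
      (fun x hx => by rw [image_eq_zero_of_notMem_tsupport hx, zero_smul])]
    have h4 := (Submodule.mem_orthogonal _ _).1 hw (H10.toL2 u) ⟨u, rfl⟩
    rw [← h4, L2.inner_def]
    refine integral_congr_ae ?_
    filter_upwards [hu] with x hx
    rw [hx]
    simp [mul_comm]
  exact (Submodule.dense_iff_topologicalClosure_eq_top (s := (H10.toL2 (Ω := Ω)).range)).2
    ((Submodule.topologicalClosure_eq_top_iff (K := (H10.toL2 (Ω := Ω)).range)).2 h)

/-- `div (u b) = b ⬝ ∇u + u div b` for `u` in `H¹₀(Ω)` and a Lipschitz field `b`. -/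
theorem H10.weakDiv_smul_ae_eq (hΩ : IsOpen Ω) (hΩb : Bornology.IsBounded Ω)
    {f : Fin N → E N → ℝ} {K : ℝ≥0} (hf : ∀ i, LipschitzWith K (f i)) {b : E N → E N}
    (hb : ∀ x ∈ Ω, ∀ i, b x i = f i x) (u : H10 Ω) :
    weakDiv Ω (fun y => H10.toL2 u y • b y) =ᵐ[volume.restrict Ω] fun x =>
      ∑ i, (f i x * H10.grad u x i
        + lineDeriv ℝ (f i) x (EuclideanSpace.single i 1) * H10.toL2 u x) := by
  have hL : IntegrableOn (H10.toL2 u) Ω := integrableOn_of_memLp_two (Lp.memLp _) hΩb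
  have hGr : ∀ i, IntegrableOn (fun x => H10.grad u x i) Ω := fun i =>
    (EuclideanSpace.proj (𝕜 := ℝ) i).integrable_comp
      (integrableOn_of_memLp_two (Lp.memLp (H10.grad u)) hΩb)
  have hfb : ∀ i, ∃ C, ∀ x ∈ Ω, ‖f i x‖ ≤ C := by
    intro i
    obtain ⟨C, hC⟩ := (hΩb.isCompact_closure).exists_bound_of_continuousOn
      (hf i).continuous.continuousOn
    exact ⟨C, fun x hx => hC x (subset_closure hx)⟩
  have hmul : ∀ (i : Fin N) (g : E N → ℝ), IntegrableOn g Ω →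
      IntegrableOn (fun x => f i x * g x) Ω := by
    intro i g hg
    obtain ⟨C, hC⟩ := hfb i
    exact Integrable.bdd_mul (c := C) hg (hf i).continuous.aestronglyMeasurable
      ((ae_restrict_iff' hΩ.measurableSet).2 (.of_forall hC))
  have hmul' : ∀ (i : Fin N) (g : E N → ℝ), IntegrableOn g Ω →
      IntegrableOn (fun x => lineDeriv ℝ (f i) x (EuclideanSpace.single i 1) * g x) Ω := by
    intro i g hg
    exact Integrable.bdd_mul (c := K * ‖(EuclideanSpace.single i 1 : E N)‖) hg
      (measurable_lineDeriv (hf i).continuous).aestronglyMeasurable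
      (.of_forall fun x => norm_lineDeriv_le_of_lipschitz ℝ (hf i))
  have hvec : (fun y => H10.toL2 u y • b y) =ᵐ[volume.restrict Ω]
      fun y => ∑ i, (f i y * H10.toL2 u y) • (EuclideanSpace.single i 1 : E N) := by
    filter_upwards [ae_restrict_mem hΩ.measurableSet] with y hy
    ext i
    simp [hb y hy, mul_comm, Finset.sum_apply, Pi.single_apply]
  refine HasWeakDiv.weakDiv_ae_eq hΩ ⟨?_, ?_, ?_⟩
  · refine IntegrableOn.locallyIntegrableOn (Integrable.congr ?_ hvec.symm)
    exact integrable_finsetSum _ fun i _ => (hmul i _ hL).smul_const _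
  · refine IntegrableOn.locallyIntegrableOn ?_
    exact integrable_finsetSum _ fun i _ => (hmul i _ (hGr i)).add (hmul' i _ hL)
  · intro ψ hψ
    have hcψ : ∀ i, Continuous fun x => gradient ψ x i := fun i =>
      (EuclideanSpace.proj i).continuous.comp hψ.continuous_gradient
    have hbdd : ∀ (g h : E N → ℝ), IntegrableOn g Ω → Continuous h → HasCompactSupport h →
        IntegrableOn (fun x => g x * h x) Ω := by
      intro g h hg hh hc
      obtain ⟨C, hC⟩ := hc.exists_bound_of_continuous hh
      exact Integrable.mul_bdd (c := C) hg hh.aestronglyMeasurable (.of_forall hC)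
    have hcs : ∀ i, HasCompactSupport fun x => gradient ψ x i := fun i =>
      hψ.hasCompactSupport_gradient.comp_left (g := fun y : E N => y i) rfl
    have i1 : ∀ i, IntegrableOn (fun x => f i x * H10.toL2 u x * gradient ψ x i) Ω := fun i =>
      hbdd _ _ (hmul i _ hL) (hcψ i) (hcs i)
    have i2 : ∀ i, IntegrableOn (fun x => f i x * H10.grad u x i * ψ x) Ω := fun i =>
      hbdd _ _ (hmul i _ (hGr i)) hψ.1.continuous hψ.2.1
    have i3 : ∀ i, IntegrableOn (fun x => lineDeriv ℝ (f i) x (EuclideanSpace.single i 1)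
        * H10.toL2 u x * ψ x) Ω := fun i =>
      hbdd _ _ (hmul' i _ hL) hψ.1.continuous hψ.2.1
    have h1 : ∫ x in Ω, inner ℝ (H10.toL2 u x • b x) (gradient ψ x)
        = ∑ i, ∫ x in Ω, f i x * H10.toL2 u x * gradient ψ x i := by
      rw [← integral_finsetSum _ fun i _ => i1 i]
      refine integral_congr_ae ?_
      filter_upwards [hvec] with x hx
      rw [hx, sum_inner]
      refine Finset.sum_congr rfl fun i _ => ?_
      rw [real_inner_smul_left, EuclideanSpace.inner_single_left]
      simp
    have h2 : ∫ x in Ω, (∑ i, (f i x * H10.grad u x i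
        + lineDeriv ℝ (f i) x (EuclideanSpace.single i 1) * H10.toL2 u x)) * ψ x
        = ∑ i, ∫ x in Ω, (f i x * H10.grad u x i * ψ x
          + lineDeriv ℝ (f i) x (EuclideanSpace.single i 1) * H10.toL2 u x * ψ x) := by
      have i4 : ∀ i, IntegrableOn (fun x => f i x * H10.grad u x i * ψ x
          + lineDeriv ℝ (f i) x (EuclideanSpace.single i 1) * H10.toL2 u x * ψ x) Ω := fun i =>
        (i2 i).add (i3 i)
      rw [← integral_finsetSum _ fun i _ => i4 i]
      refine integral_congr_ae (.of_forall fun x => ?_)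
      simp only [Finset.sum_mul, add_mul]
    rw [h1, h2, ← Finset.sum_neg_distrib]
    refine Finset.sum_congr rfl fun i _ => ?_
    have h3 := H10.integral_lipschitz_mul (hf i) hψ i u
    have h4 : ∫ x in Ω, H10.toL2 u x * (f i x * gradient ψ x i
        + lineDeriv ℝ (f i) x (EuclideanSpace.single i 1) * ψ x)
        = (∫ x in Ω, f i x * H10.toL2 u x * gradient ψ x i) + ∫ x in Ω,
          lineDeriv ℝ (f i) x (EuclideanSpace.single i 1) * H10.toL2 u x * ψ x := by
      rw [← integral_add (i1 i) (i3 i)]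
      refine integral_congr_ae (.of_forall fun x => ?_)
      simp only
      ring
    have h5 : ∫ x in Ω, H10.grad u x i * (f i x * ψ x)
        = ∫ x in Ω, f i x * H10.grad u x i * ψ x := by
      refine integral_congr_ae (.of_forall fun x => ?_)
      simp only
      ring
    rw [integral_add (i2 i) (i3 i)]
    rw [h4, h5] at h3
    linarith

end Sobolev

/-! ### The forms of the equation as elements of the Bochner space over the dual -/

section Forms

variable {N : ℕ} {Ω : Set (E N)}

theorem memLp_fun_add {X α : Type*} [NormedAddCommGroup X] [MeasurableSpace α] {μ : Measure α}
    {F₁ F₂ : α → X} (h₁ : MemLp F₁ 2 μ) (h₂ : MemLp F₂ 2 μ) :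
    MemLp (fun t => F₁ t + F₂ t) 2 μ :=
  h₁.add h₂

theorem memLp_sub_sub_sub_smul {X α : Type*} [NormedAddCommGroup X] [NormedSpace ℝ X]
    [MeasurableSpace α] {μ : Measure α} {F₁ F₂ F₃ F₄ : α → X} (h₁ : MemLp F₁ 2 μ)
    (h₂ : MemLp F₂ 2 μ) (h₃ : MemLp F₃ 2 μ) (h₄ : MemLp F₄ 2 μ) (c : ℝ) :
    MemLp (fun t => F₁ t - F₂ t - F₃ t - c • F₄ t) 2 μ :=
  ((h₁.sub h₂).sub h₃).sub (h₄.const_smul c)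

theorem integral_sub_sub_sub_smul_apply {X α : Type*} [NormedAddCommGroup X] [NormedSpace ℝ X]
    [MeasurableSpace α] {μ : Measure α} {F₁ F₂ F₃ F₄ : α → StrongDual ℝ X} {ξ : α → X}
    (h₁ : Integrable (fun t => F₁ t (ξ t)) μ) (h₂ : Integrable (fun t => F₂ t (ξ t)) μ)
    (h₃ : Integrable (fun t => F₃ t (ξ t)) μ) (h₄ : Integrable (fun t => F₄ t (ξ t)) μ) {c : ℝ} :
    ∫ t, (F₁ t - F₂ t - F₃ t - c • F₄ t) (ξ t) ∂μ = (∫ t, F₁ t (ξ t) ∂μ) - (∫ t, F₂ t (ξ t) ∂μ)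
      - (∫ t, F₃ t (ξ t) ∂μ) - c * ∫ t, F₄ t (ξ t) ∂μ := by
  have h12 : Integrable (fun t => F₁ t (ξ t) - F₂ t (ξ t)) μ := h₁.sub h₂
  have h123 : Integrable (fun t => F₁ t (ξ t) - F₂ t (ξ t) - F₃ t (ξ t)) μ := h12.sub h₃
  rw [← integral_const_mul, ← integral_sub h₁ h₂, ← integral_sub h12 h₃,
    ← integral_sub h123 (h₄.const_mul c)]
  rfl

theorem restrict_prod_restrict (T : ℝ) :
    (volume.restrict (Ioo 0 T)).prod (volume.restrict Ω)
      = (volume : Measure (ℝ × E N)).restrict (Ioo 0 T ×ˢ Ω) := by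
  rw [Measure.prod_restrict, Measure.volume_eq_prod]

theorem memLp_top_of_lipschitzOnWith (hΩ : IsOpen Ω) (hΩb : Bornology.IsBounded Ω) {T : ℝ}
    {f : ℝ × E N → ℝ} {K : ℝ≥0} (hf : LipschitzOnWith K f (Icc 0 T ×ˢ closure Ω)) :
    MemLp f ⊤ ((volume.restrict (Ioo 0 T)).prod (volume.restrict Ω)) := by
  rw [restrict_prod_restrict]
  have hsub : Ioo 0 T ×ˢ Ω ⊆ Icc 0 T ×ˢ closure Ω := prod_mono Ioo_subset_Icc_self subset_closure
  have hm : MeasurableSet (Ioo 0 T ×ˢ Ω) := (isOpen_Ioo.prod hΩ).measurableSet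
  obtain ⟨C, hC⟩ := (isCompact_Icc.prod hΩb.isCompact_closure).exists_bound_of_continuousOn
    hf.continuousOn
  exact memLp_top_of_bound ((hf.continuousOn.mono hsub).aestronglyMeasurable hm) C
    ((ae_restrict_iff' hm).2 (.of_forall fun p hp => hC p (hsub hp)))

variable {D : HypData Ω} {T : ℝ}

theorem HypData.Regular.exists_formB (hD : D.Regular T) (hΩ : IsOpen Ω)
    (hΩb : Bornology.IsBounded Ω) {V : ℝ → H10 Ω} (hV : MemL2Time T V) :
    ∃ F : ℝ → Hneg1 Ω, MemL2Time T F ∧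
      ∀ᵐ t ∂(volume.restrict (Ioo 0 T)), ∀ φ, F t φ = D.formB t (V t) φ := by
  have hk : ∀ ij : Fin N × Fin N, MemLp (fun p : ℝ × E N => D.B p.1 p.2 ij.1 ij.2) ⊤
      ((volume.restrict (Ioo 0 T)).prod (volume.restrict Ω)) := by
    intro ij
    obtain ⟨K, hK⟩ := hD.lip_B ij.1 ij.2
    exact memLp_top_of_lipschitzOnWith hΩ hΩb hK
  obtain ⟨F, hF, hF'⟩ := exists_memLp_strongDual_of_sum hk
    (fun ij => EuclideanSpace.proj ij.2) (fun ij => EuclideanSpace.proj ij.1)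
    (H10.grad.comp_memLp' hV) (H10.grad (Ω := Ω))
  refine ⟨F, hF, ?_⟩
  filter_upwards [hF'] with t ht φ
  rw [(ht φ).2, HypData.formB]
  refine integral_congr_ae (.of_forall fun x => ?_)
  simp [Matrix.mulVec, dotProduct, Finset.sum_mul, mul_assoc, Fintype.sum_prod_type]

theorem HypData.Regular.exists_forma (hD : D.Regular T) {V : ℝ → H10 Ω} (hV : MemL2Time T V) :
    ∃ F : ℝ → Hneg1 Ω, MemL2Time T F ∧
      ∀ᵐ t ∂(volume.restrict (Ioo 0 T)), ∀ φ, F t φ = D.forma t (V t) φ := by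
  have hk : ∀ i, MemLp (fun p : ℝ × E N => D.a p.1 p.2 i) ⊤
      ((volume.restrict (Ioo 0 T)).prod (volume.restrict Ω)) := by
    intro i
    rw [restrict_prod_restrict]
    exact (EuclideanSpace.proj (𝕜 := ℝ) i).comp_memLp' hD.bdd_a
  obtain ⟨F, hF, hF'⟩ := exists_memLp_strongDual_of_sum hk
    (fun i => EuclideanSpace.proj i) (fun _ => ContinuousLinearMap.id ℝ ℝ)
    (H10.grad.comp_memLp' hV) (H10.toL2 (Ω := Ω))
  refine ⟨F, hF, ?_⟩
  filter_upwards [hF'] with t ht φ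
  rw [(ht φ).2, HypData.forma]
  refine integral_congr_ae (.of_forall fun x => ?_)
  simp only [PiLp.inner_apply, Finset.sum_mul]
  refine Finset.sum_congr rfl fun i _ => ?_
  simp
  ring

theorem HypData.Regular.exists_formb (hD : D.Regular T) (hΩ : IsOpen Ω)
    (hΩb : Bornology.IsBounded Ω) {V' : ℝ → L2 Ω} (hV' : MemL2Time T V') :
    ∃ F : ℝ → Hneg1 Ω, MemL2Time T F ∧
      ∀ᵐ t ∂(volume.restrict (Ioo 0 T)), ∀ φ, F t φ = D.formb t (V' t) φ := by
  obtain ⟨K, hK⟩ := hD.lip_b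
  have hKi : ∀ i : Fin N, LipschitzOnWith K (fun p : ℝ × E N => D.b p.1 p.2 i)
      (Icc 0 T ×ˢ closure Ω) := by
    intro i
    have h1 : LipschitzWith 1 (fun y : E N => y i) :=
      LipschitzWith.of_dist_le_mul fun y z => by
        rw [NNReal.coe_one, one_mul, dist_eq_norm, dist_eq_norm]
        exact PiLp.norm_apply_le (y - z) i
    have h2 := h1.comp_lipschitzOnWith hK
    rwa [one_mul] at h2
  -- Extending `b` in all variables together keeps the coefficient `div b` jointly measurable.
  choose f hf hfb using fun i => (hKi i).extend_real
  let e : Fin N → ℝ × E N := fun i => (0, EuclideanSpace.single i 1)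
  have hk₁ : ∀ i, MemLp (f i) ⊤ ((volume.restrict (Ioo 0 T)).prod (volume.restrict Ω)) := fun i =>
    memLp_top_of_lipschitzOnWith hΩ hΩb (hf i).lipschitzOnWith
  have hk₂ : ∀ i, MemLp (fun p => lineDeriv ℝ (f i) p (e i)) ⊤
      ((volume.restrict (Ioo 0 T)).prod (volume.restrict Ω)) := fun i =>
    memLp_top_of_bound (measurable_lineDeriv (hf i).continuous).aestronglyMeasurable (K * ‖e i‖)
      (.of_forall fun p => norm_lineDeriv_le_of_lipschitz ℝ (hf i))
  obtain ⟨F₁, hF₁, hF₁'⟩ := exists_memLp_strongDual_of_sum hk₁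
    (fun _ => ContinuousLinearMap.id ℝ ℝ) (fun i => EuclideanSpace.proj i) hV' (H10.grad (Ω := Ω))
  obtain ⟨F₂, hF₂, hF₂'⟩ := exists_memLp_strongDual_of_sum hk₂
    (fun _ => ContinuousLinearMap.id ℝ ℝ) (fun _ => ContinuousLinearMap.id ℝ ℝ) hV'
    (H10.toL2 (Ω := Ω))
  refine ⟨fun t => F₁ t + F₂ t, memLp_fun_add hF₁ hF₂, ?_⟩
  filter_upwards [hF₁', hF₂', ae_restrict_mem measurableSet_Ioo] with t h1 h2 ht φ
  have hlip : ∀ i, LipschitzWith K (fun x => f i (t, x)) := fun i => by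
    have h3 := (hf i).comp (LipschitzWith.prodMk_left (β := E N) t)
    rwa [mul_one] at h3
  have hdiv := H10.weakDiv_smul_ae_eq hΩ hΩb hlip (b := D.b t)
    (fun x hx i => hfb i (x := (t, x)) ⟨Ioo_subset_Icc_self ht, subset_closure hx⟩) φ
  have hline : ∀ i x, lineDeriv ℝ (fun y => f i (t, y)) x (EuclideanSpace.single i 1)
      = lineDeriv ℝ (f i) (t, x) (e i) := by
    intro i x
    simp [lineDeriv, e]
  rw [add_apply, (h1 φ).2, (h2 φ).2, ← integral_add (h1 φ).1 (h2 φ).1, HypData.formb]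
  refine integral_congr_ae ?_
  filter_upwards [hdiv] with x hx
  rw [hx]
  rw [← Finset.sum_add_distrib, Finset.mul_sum]
  refine Finset.sum_congr rfl fun i _ => ?_
  rw [hline]
  simp
  ring

theorem HypData.Regular.exists_formg (hD : D.Regular T) :
    ∃ F : ℝ → Hneg1 Ω, MemL2Time T F ∧
      ∀ᵐ t ∂(volume.restrict (Ioo 0 T)), ∀ φ, F t φ = D.formg t φ := by
  have hg := hD.sq_g
  rw [← restrict_prod_restrict] at hg
  have hsq := hg.integrable_sq
  refine exists_memLp_strongDual
    (γ := fun t => ‖H10.toL2 (Ω := Ω)‖ * √(∫ x in Ω, D.g t x ^ 2)) ?_ ?_ ?_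
  · refine MemLp.const_mul ?_ _
    have hm : AEStronglyMeasurable (fun t => ∫ x in Ω, D.g t x ^ 2)
      (volume.restrict (Ioo 0 T)) := hsq.1.integral_prod_right'
    refine (memLp_two_iff_integrable_sq
      (Real.continuous_sqrt.comp_aestronglyMeasurable hm)).2 ?_
    refine hsq.integral_prod_left.congr (.of_forall fun t => ?_)
    exact (Real.sq_sqrt (integral_nonneg fun x => sq_nonneg _)).symm
  · filter_upwards [hg.1.prodMk_left, hsq.prod_right_ae] with t ht1 ht2
    have ht : MemLp (fun x => D.g t x) 2 (volume.restrict Ω) :=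
      (memLp_two_iff_integrable_sq ht1).2 ht2
    refine ⟨toHneg1 (ht.toLp _), fun φ => ?_, ?_⟩
    · change inner ℝ (ht.toLp _) (H10.toL2 φ) = _
      rw [L2.inner_def, HypData.formg]
      refine integral_congr_ae ?_
      filter_upwards [ht.coeFn_toLp] with x hx
      rw [hx]
      simp [mul_comm]
    · have h1 : ‖ht.toLp _‖ = √(∫ x in Ω, D.g t x ^ 2) := by
        rw [norm_eq_sqrt_real_inner, L2.inner_def]
        congr 1
        refine integral_congr_ae ?_
        filter_upwards [ht.coeFn_toLp] with x hx
        rw [hx]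
        simp [sq]
      rw [← h1, mul_comm, ← innerSL_apply_norm (𝕜 := ℝ) (ht.toLp _)]
      exact ContinuousLinearMap.opNorm_comp_le _ _
  · intro φ
    exact AEStronglyMeasurable.integral_prod_right'
      (f := fun p : ℝ × E N => D.g p.1 p.2 * H10.toL2 φ p.2)
      (hg.1.mul (Lp.aestronglyMeasurable _).comp_snd)

/-- The lower order terms of the equation form an element of `L²(0,T;H⁻¹(Ω))`, and the weak
formulation says that this element is the weak time derivative of `v̇`. -/
theorem HypData.Regular.exists_residual (hD : D.Regular T) (hΩ : IsOpen Ω)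
    (hΩb : Bornology.IsBounded Ω) (hT : 0 < T) {V : ℝ → H10 Ω} {V' : ℝ → L2 Ω}
    (hV : MemL2Time T V) (hV' : MemL2Time T V') :
    ∃ F : ℝ → Hneg1 Ω, MemL2Time T F ∧
      (∀ᵐ t ∂(volume.restrict (Ioo 0 T)), ∀ φ, F t φ = D.formg t φ - D.formB t (V t) φ
        - D.forma t (V t) φ - 2 * D.formb t (V' t) φ) ∧
      ((∀ (ξ : ℝ → H10 Ω) (ξ' : ℝ → L2 Ω), MemL2Time T ξ →
        MemH10Time T (fun t => H10.toL2 (ξ t)) ξ' →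
        -(∫ t in Ioo 0 T, inner ℝ (V' t) (ξ' t))
          + (∫ t in Ioo 0 T, D.formB t (V t) (ξ t))
          + (∫ t in Ioo 0 T, D.forma t (V t) (ξ t))
          + 2 * (∫ t in Ioo 0 T, D.formb t (V' t) (ξ t))
        = ∫ t in Ioo 0 T, D.formg t (ξ t)) ↔
      HasWeakTimeDeriv T (fun t => toHneg1 (V' t)) F) := by
  obtain ⟨FB, hFB, hB⟩ := hD.exists_formB hΩ hΩb hV
  obtain ⟨Fa, hFa, ha⟩ := hD.exists_forma hV
  obtain ⟨Fb, hFb, hb⟩ := hD.exists_formb hΩ hΩb hV'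
  obtain ⟨Fg, hFg, hg⟩ := hD.exists_formg
  have hF : MemL2Time T (fun t => Fg t - FB t - Fa t - (2 : ℝ) • Fb t) :=
    memLp_sub_sub_sub_smul hFg hFB hFa hFb 2
  refine ⟨fun t => Fg t - FB t - Fa t - (2 : ℝ) • Fb t, hF, ?_, ?_⟩
  · filter_upwards [hB, ha, hb, hg] with t h1 h2 h3 h4 φ
    simp only [sub_apply, smul_apply, smul_eq_mul, h1, h2, h3, h4]
  · refine Iff.trans ?_ (hasWeakTimeDeriv_iff hT H10.toL2 (H10.toL2_injective hΩ hΩb)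
      (H10.denseRange_toL2 hΩ hΩb) hV' hF).symm
    refine forall_congr' fun ξ => forall_congr' fun ξ' => forall_congr' fun hξ =>
      forall_congr' fun _ => ?_
    have iB := integrable_apply_of_memLp hFB hξ
    have ia := integrable_apply_of_memLp hFa hξ
    have ib := integrable_apply_of_memLp hFb hξ
    have ig := integrable_apply_of_memLp hFg hξ
    have eB : ∫ t in Ioo 0 T, D.formB t (V t) (ξ t) = ∫ t in Ioo 0 T, FB t (ξ t) :=
      integral_congr_ae (hB.mono fun t ht => (ht _).symm)
    have ea : ∫ t in Ioo 0 T, D.forma t (V t) (ξ t) = ∫ t in Ioo 0 T, Fa t (ξ t) :=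
      integral_congr_ae (ha.mono fun t ht => (ht _).symm)
    have eb : ∫ t in Ioo 0 T, D.formb t (V' t) (ξ t) = ∫ t in Ioo 0 T, Fb t (ξ t) :=
      integral_congr_ae (hb.mono fun t ht => (ht _).symm)
    have eg : ∫ t in Ioo 0 T, D.formg t (ξ t) = ∫ t in Ioo 0 T, Fg t (ξ t) :=
      integral_congr_ae (hg.mono fun t ht => (ht _).symm)
    have eF : ∫ t in Ioo 0 T, (Fg t - FB t - Fa t - (2 : ℝ) • Fb t) (ξ t)
        = (∫ t in Ioo 0 T, Fg t (ξ t)) - (∫ t in Ioo 0 T, FB t (ξ t))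
          - (∫ t in Ioo 0 T, Fa t (ξ t)) - 2 * ∫ t in Ioo 0 T, Fb t (ξ t) := by
      exact integral_sub_sub_sub_smul_apply ig iB ia ib
    rw [eB, ea, eb, eg, eF]
    constructor <;> intro h <;> linarith

end Forms

end HypWave

theorem mainTheorem8 {N : ℕ} {Ω : Set (HypWave.E N)} (hΩ : IsOpen Ω)
    (hΩb : Bornology.IsBounded Ω) {T : ℝ} (hT : 0 < T) (D : HypWave.HypData Ω)
    (hD : D.Regular T) (v : ℝ → HypWave.E N → ℝ) :
    HypWave.IsWeakSol T D v ↔ HypWave.IsStrongWeakSol T D v := by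
  constructor
  · rintro ⟨V, V', hA, h⟩
    obtain ⟨F, hF, hF', hiff⟩ := hD.exists_residual hΩ hΩb hT hA.mem hA.mem_deriv
    refine ⟨V, V', F, hA, hF, hiff.1 h, ?_⟩
    filter_upwards [hF'] with t ht φ
    rw [ht φ]
    ring
  · rintro ⟨V, V', V'', hA, -, hder, h⟩
    obtain ⟨F, hF, hF', hiff⟩ := hD.exists_residual hΩ hΩb hT hA.mem hA.mem_deriv
    refine ⟨V, V', hA, hiff.2 fun θ hθ => ?_⟩
    rw [hder θ hθ]
    refine congrArg Neg.neg (integral_congr_ae ?_)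
    filter_upwards [h, hF'] with t h1 h2
    have h3 : V'' t = F t := by
      ext φ
      rw [h2 φ, ← h1 φ]
      ring
    rw [h3]
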